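/- On $\mathbb R^2$ let $\theta$ be a formal real parameter and, for formal power series $f=\sum_k\theta^k f_k$, $g=\sum_k\theta^k g_k$ with smooth complex coefficients, let $$f*g=\sum_{n\ge 0}\frac{1}{n!}\Big(\frac{i\theta}{2}\Big)^n f\,\big(\overleftarrow{\partial}_\mu\epsilon^{\mu\nu}\overrightarrow{\partial}_\nu\big)^n g,\qquad \epsilon^{12}=-\epsilon^{21}=1,\quad \epsilon^{11}=\epsilon^{22}=0,$$ be the formal Moyal product. Put $\partial=\frac{1}{\sqrt2}(\partial_1-i\partial_2)$ and $\bar\partial=\frac{1}{\sqrt2}(\partial_1+i\partial_2)$. Let $A_\mu=\sum_k\theta^kA_{\mu,k}$ ($\mu=1,2$), with real smooth coefficients, and $\phi=\sum_k\theta^k\phi_k$, with complex smooth coefficients, and put $A=\frac1{\sqrt2}(A_1-iA_2)$, $\bar A=\frac1{\sqrt2}(A_1+iA_2)$ and $$B=-i\big(\partial\bar A-\bar\partial A-i(A*\bar A-\bar A*A)\big)=\sum_k\theta^kB_k .$$ Suppose that $(A,\phi)$ solves the noncommutative vortex equations $$\bar\partial\phi-i\bar A*\phi=0,\qquad B+\phi*\bar\phi-1=0$$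 in every order of $\theta$; in particular its order-zero part $(A_0,\phi_0)$ solves the commutative vortex equations. Suppose that $B_0=\partial_1A_{2,0}-\partial_2A_{1,0}$ is integrable and that the commutative solution has vortex number $\frac1{2\pi}\int_{\mathbb R^2}B_0\,d^2x=N_0$. Suppose moreover that, with $r=|x|$, 1. (asymptotics may be differentiated) for every $k\ge0$ and every multi-index $\alpha$, $\partial^\alpha\phi_k=O(r^{-|\alpha|})$ as $r\to\infty$; 2. for every $k\ge1$ there are $\epsilon>0$ and $C$ such that $|\phi_k|<Cr^{-\epsilon}$ and $|\partial_r\phi_k|<Cr^{-\epsilon+1}$ for all large $r$. Then every $B_k$ is integrable on $\mathbb R^2$, and $$\frac1{2\pi}\int_{\mathbb R^2}B\,d^2x:=\sum_k\theta^k\,\frac1{2\pi}\int_{\mathbb R^2}B_k\,d^2x=N_0$$ as formal power series in $\theta$; that is, $\int_{\mathbb R^2} B_k\,d^2x=0$ for all $k\ge1$. -/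

import Mathlib

open MeasureTheory
open scoped ContDiff ComplexConjugate

noncomputable section

namespace NCVortex

/-- The Euclidean plane, with coordinates `x 0` and `x 1` (the `x¹` and `x²` of the physics notation). -/
abbrev Plane : Type := EuclideanSpace ℝ (Fin 2)

/-- The partial derivative `∂_μ f`. -/
def pd (μ : Fin 2) (f : Plane → ℂ) : Plane → ℂ :=
  fun x => fderiv ℝ f x (EuclideanSpace.single μ 1)

/-- The radial derivative `∂_r f` (meaningful away from the origin). -/
def radialDeriv (f : Plane → ℂ) : Plane → ℂ :=
  fun x => fderiv ℝ f x (‖x‖⁻¹ • x)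

/-- `∂ = (∂₁ - i ∂₂) / √2`. -/
def dz (f : Plane → ℂ) : Plane → ℂ :=
  fun x => (pd 0 f x - Complex.I * pd 1 f x) / (Real.sqrt 2 : ℂ)

/-- `∂̄ = (∂₁ + i ∂₂) / √2`. -/
def dzbar (f : Plane → ℂ) : Plane → ℂ :=
  fun x => (pd 0 f x + Complex.I * pd 1 f x) / (Real.sqrt 2 : ℂ)

/-- `f (∂⃖_μ ε^{μν} ∂⃗_ν)ⁿ g`, with `ε^{12} = 1`. -/
def bidiff : ℕ → (Plane → ℂ) → (Plane → ℂ) → Plane → ℂ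
  | 0, f, g => fun x => f x * g x
  | n + 1, f, g => fun x => bidiff n (pd 0 f) (pd 1 g) x - bidiff n (pd 1 f) (pd 0 g) x

/-- A formal power series `∑ₖ θᵏ fₖ` whose coefficients are functions on the plane. -/
abbrev FormalField : Type := ℕ → Plane → ℂ

/-- The formal Moyal product
`f * g = ∑ₙ (1 / n!) f ((i θ / 2) ∂⃖_μ ε^{μν} ∂⃗_ν)ⁿ g`: its coefficient of `θᵏ` is the sum over
`l + m + n = k` of `((i / 2)ⁿ / n!) f_l (∂⃖_μ ε^{μν} ∂⃗_ν)ⁿ g_m`. -/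
def moyal (f g : FormalField) : FormalField :=
  fun k x => ∑ p ∈ Finset.HasAntidiagonal.antidiagonal k, ∑ q ∈ Finset.HasAntidiagonal.antidiagonal p.1,
    (Complex.I / 2) ^ p.2 / (p.2.factorial : ℂ) * bidiff p.2 (f q.1) (g q.2) x

/-- Complex conjugation of a formal field (the parameter `θ` is real). -/
def fconj (f : FormalField) : FormalField :=
  fun k x => conj (f k x)

/-- `A = (A₁ - i A₂) / √2`, for a formal gauge field with real components;
`a k μ` is the coefficient of `θᵏ` in the component `A_μ`. -/
def gaugeA (a : ℕ → Fin 2 → Plane → ℝ) : FormalField :=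
  fun k x => ((a k 0 x : ℂ) - Complex.I * (a k 1 x : ℂ)) / (Real.sqrt 2 : ℂ)

/-- `Ā = (A₁ + i A₂) / √2`. -/
def gaugeAbar (a : ℕ → Fin 2 → Plane → ℝ) : FormalField :=
  fun k x => ((a k 0 x : ℂ) + Complex.I * (a k 1 x : ℂ)) / (Real.sqrt 2 : ℂ)

/-- The noncommutative magnetic field `B = -i F_{z z̄}`, where
`F_{z z̄} = ∂ Ā - ∂̄ A - i (A * Ā - Ā * A)`. -/
def magneticField (a : ℕ → Fin 2 → Plane → ℝ) : FormalField :=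
  fun k x => -Complex.I *
    (dz (gaugeAbar a k) x - dzbar (gaugeA a k) x
      - Complex.I * (moyal (gaugeA a) (gaugeAbar a) k x - moyal (gaugeAbar a) (gaugeA a) k x))

/-- The magnetic field `∂₁ A₂ - ∂₂ A₁` of a gauge field on the commutative plane. -/
def commMagneticField (a : Fin 2 → Plane → ℝ) : Plane → ℝ :=
  fun x => fderiv ℝ (a 1) x (EuclideanSpace.single 0 1)
    - fderiv ℝ (a 0) x (EuclideanSpace.single 1 1)

/-- The noncommutative vortex equations `(∂̄ - i Ā) * φ = 0` and `B + φ * φ̄ - 1 = 0`, imposed on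
every power of `θ`. In order zero they are the commutative vortex equations for `(A₀, φ₀)`. -/
structure IsVortexSolution (a : ℕ → Fin 2 → Plane → ℝ) (φ : FormalField) : Prop where
  smooth_gauge : ∀ k μ, ContDiff ℝ ∞ (a k μ)
  smooth_higgs : ∀ k, ContDiff ℝ ∞ (φ k)
  dbar_eq : ∀ k x, dzbar (φ k) x - Complex.I * moyal (gaugeAbar a) φ k x = 0
  field_eq : ∀ k x,
    magneticField a k x + moyal φ (fconj φ) k x - (if k = 0 then 1 else 0) = 0

/-- The asymptotics of a bounded field each of whose derivatives gains a power of `1 / r`: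
`∂^α f = O(r^{-|α|})` as `r → ∞`, for every multi-index `α`. -/
def TameAtInfinity (f : Plane → ℂ) : Prop :=
  ∀ n : ℕ, ∃ C R : ℝ, ∀ x : Plane, R < ‖x‖ →
    ‖iteratedFDeriv ℝ n f x‖ ≤ C * ‖x‖ ^ (-(n : ℝ))

/-- The vortex number `(1 / 2π) ∫ B d²x`, a formal power series in `θ`. -/
def vortexNumber (a : ℕ → Fin 2 → Plane → ℝ) : PowerSeries ℂ :=
  PowerSeries.mk fun k => 1 / (2 * (Real.pi : ℂ)) * ∫ x, magneticField a k x

end NCVortex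

end

noncomputable section

namespace NCVortex

open Asymptotics Bornology Filter Topology

/-! ### Calculus of partial derivatives of smooth functions. -/

section PartialDerivatives

variable {f g : Plane → ℂ}

/-! Call a smooth function a symbol of order `m` if its derivatives of order `j` are
`O(r^{-(m+j)})`. Symbols form a graded algebra in which each derivative gains one order. So a Moyal
product is the commutative product of power series plus a tail that is two orders better and
involves only lower powers of `θ` of the two factors.

By the field equation `B_0 = 1 - |φ_0|²`, so its integrability and `∇φ_0 = O(1/r)` keep `φ_0` away
from zero at infinity (`IsSymbol.eventually_half_le_norm`). One may therefore divide by `φ`, and the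
equation `∂̄φ = i Ā * φ` makes every `A_k` a symbol of order 1 (`isSymbol_gaugeAbar`). This gives
only `B_k = O(r^{-2})`, which is borderline for integrability. Differentiating the field equation
bounds the covariant derivative `Dφ` by order 3, and the curvature identity for `Bφ` then puts `B`
in order 4 (`isSymbol_magneticField`), which is integrable.

For `k ≥ 1`, `φ_k → 0` improves `∇φ_k` to `o(1/r)` (`isLittleO_pd_of_tendsto_zero`), hence `A_k =
o(1/r)` (`isLittleO_gaugeAbar`). Since `B_k` is a curl of `A_k` plus Moyal commutator terms, which
are divergences of rapidly decaying currents, it has no flux through infinity and integrates to zero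
(`HasNullFlux.integral_eq_zero`). -/

lemma contDiff_pd (hf : ContDiff ℝ ∞ f) (μ : Fin 2) : ContDiff ℝ ∞ (pd μ f) :=
  (hf.fderiv_right (by simp)).clm_apply contDiff_const

lemma pd_add (hf : ContDiff ℝ ∞ f) (hg : ContDiff ℝ ∞ g) (μ : Fin 2) :
    pd μ (f + g) = pd μ f + pd μ g := by
  funext x
  simp [pd, fderiv_add (hf.differentiable (by simp) x) (hg.differentiable (by simp) x)]

lemma pd_mul (hf : ContDiff ℝ ∞ f) (hg : ContDiff ℝ ∞ g) (μ : Fin 2) :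
    pd μ (f * g) = pd μ f * g + f * pd μ g := by
  funext x
  simp [pd, fderiv_mul (hf.differentiable (by simp) x) (hg.differentiable (by simp) x)]
  ring

lemma pd_const (c : ℂ) (μ : Fin 2) : pd μ (fun _ => c) = 0 := by
  funext x
  simp [pd]

lemma pd_const_mul (hf : ContDiff ℝ ∞ f) (c : ℂ) (μ : Fin 2) :
    pd μ ((fun _ => c) * f) = (fun _ => c) * pd μ f := by
  rw [pd_mul contDiff_const hf, pd_const, zero_mul, zero_add]

lemma pd_neg (μ : Fin 2) : pd μ (-f) = -pd μ f := by
  funext x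
  simp only [pd, fderiv_neg, Pi.neg_apply, neg_apply]

lemma pd_sub (hf : ContDiff ℝ ∞ f) (hg : ContDiff ℝ ∞ g) (μ : Fin 2) :
    pd μ (f - g) = pd μ f - pd μ g := by
  rw [sub_eq_add_neg, pd_add hf (show ContDiff ℝ ∞ (-g) from hg.neg), pd_neg, sub_eq_add_neg]

lemma pd_sum {ι : Type*} (s : Finset ι) (F : ι → Plane → ℂ) (hF : ∀ i ∈ s, ContDiff ℝ ∞ (F i))
    (μ : Fin 2) : pd μ (∑ i ∈ s, F i) = ∑ i ∈ s, pd μ (F i) := by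
  funext x
  simp [pd, fderiv_sum fun i hi => (hF i hi).differentiable (by simp) x]

lemma contDiff_conj (hf : ContDiff ℝ ∞ f) : ContDiff ℝ ∞ (fun x => conj (f x)) :=
  Complex.conjCLE.contDiff.comp hf

lemma pd_conj (hf : ContDiff ℝ ∞ f) (μ : Fin 2) :
    pd μ (fun x => conj (f x)) = fun x => conj (pd μ f x) := by
  funext x
  have h := (Complex.conjCLE.hasFDerivAt (x := f x)).comp x
    (hf.differentiable (by simp) x).hasFDerivAt
  have h' : fderiv ℝ (fun x => conj (f x)) x = _ := h.fderiv
  simp [pd, h']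

lemma pd_comm (hf : ContDiff ℝ ∞ f) (μ ν : Fin 2) : pd μ (pd ν f) = pd ν (pd μ f) := by
  funext x
  have hd : DifferentiableAt ℝ (fderiv ℝ f) x :=
    (hf.fderiv_right (m := ∞) (by simp)).differentiable (by simp) x
  have key : ∀ α β : Fin 2, pd α (pd β f) x =
      fderiv ℝ (fderiv ℝ f) x (EuclideanSpace.single α 1) (EuclideanSpace.single β 1) := by
    intro α β
    have : pd β f = fun y => fderiv ℝ f y (EuclideanSpace.single β 1) := rfl
    rw [this, pd, fderiv_clm_apply hd (differentiableAt_const _)]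
    simp
  rw [key, key]
  exact (hf.contDiffAt.isSymmSndFDerivAt
    (by simpa using WithTop.coe_le_coe.2 (le_top : (2 : ℕ∞) ≤ ⊤))) _ _

end PartialDerivatives

/-! ### Symbol classes: decay that improves with each derivative. -/

/-- The partial derivatives of `f` of order `j ≤ n` are `O(r^{-(m + j)})`. -/
def SymbolUpTo : ℕ → ℕ → (Plane → ℂ) → Prop
  | 0, m, f => f =O[cobounded Plane] fun x => ‖x‖⁻¹ ^ m
  | n + 1, m, f => (f =O[cobounded Plane] fun x => ‖x‖⁻¹ ^ m) ∧
      ∀ μ, SymbolUpTo n (m + 1) (pd μ f)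

lemma isBigO_inv_norm_pow {m k : ℕ} (h : m ≤ k) :
    (fun x : Plane => ‖x‖⁻¹ ^ k) =O[cobounded Plane] fun x => ‖x‖⁻¹ ^ m := by
  refine IsBigO.of_bound 1 ?_
  filter_upwards [eventually_cobounded_le_norm (E := Plane) 1] with x hx
  rw [one_mul, norm_pow, norm_pow, norm_inv, norm_norm]
  exact pow_le_pow_of_le_one (by positivity) (inv_le_one_of_one_le₀ hx) h

namespace SymbolUpTo

variable {n m k : ℕ} {f g : Plane → ℂ}

lemma of_succ (h : SymbolUpTo (n + 1) m f) : SymbolUpTo n m f := by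
  induction n generalizing m f with
  | zero => exact h.1
  | succ n ih => exact ⟨h.1, fun μ => ih (h.2 μ)⟩

lemma mono (h : SymbolUpTo n k f) (hmk : m ≤ k) : SymbolUpTo n m f := by
  induction n generalizing m k f with
  | zero => exact IsBigO.trans h (isBigO_inv_norm_pow hmk)
  | succ n ih => exact ⟨h.1.trans (isBigO_inv_norm_pow hmk), fun μ => ih (h.2 μ) (by omega)⟩

lemma add (hf : ContDiff ℝ ∞ f) (hg : ContDiff ℝ ∞ g) (h : SymbolUpTo n m f)
    (h' : SymbolUpTo n m g) : SymbolUpTo n m (f + g) := by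
  induction n generalizing m f g with
  | zero => exact IsBigO.add h h'
  | succ n ih =>
    refine ⟨h.1.add h'.1, fun μ => ?_⟩
    rw [pd_add hf hg]
    exact ih (contDiff_pd hf μ) (contDiff_pd hg μ) (h.2 μ) (h'.2 μ)

lemma neg (h : SymbolUpTo n m f) : SymbolUpTo n m (-f) := by
  induction n generalizing m f with
  | zero => exact IsBigO.neg_left h
  | succ n ih =>
    refine ⟨h.1.neg_left, fun μ => ?_⟩
    rw [pd_neg]
    exact ih (h.2 μ)

lemma mul (hf : ContDiff ℝ ∞ f) (hg : ContDiff ℝ ∞ g) (h : SymbolUpTo n m f)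
    (h' : SymbolUpTo n k g) : SymbolUpTo n (m + k) (f * g) := by
  have key : ∀ {m k : ℕ} {f g : Plane → ℂ}, (f =O[cobounded Plane] fun x => ‖x‖⁻¹ ^ m) →
      (g =O[cobounded Plane] fun x => ‖x‖⁻¹ ^ k) →
      (f * g) =O[cobounded Plane] fun x => ‖x‖⁻¹ ^ (m + k) := by
    intro m k f g h h'
    simp only [pow_add]
    exact h.mul h'
  induction n generalizing m k f g with
  | zero => exact key h h'
  | succ n ih =>
    refine ⟨key h.1 h'.1, fun μ => ?_⟩
    rw [pd_mul hf hg]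
    refine add ((contDiff_pd hf μ).mul hg) (hf.mul (contDiff_pd hg μ)) ?_ ?_
    · exact (ih (contDiff_pd hf μ) hg (h.2 μ) h'.of_succ).mono (by omega)
    · exact (ih hf (contDiff_pd hg μ) h.of_succ (h'.2 μ)).mono (by omega)

lemma conjugate (hf : ContDiff ℝ ∞ f) (h : SymbolUpTo n m f) :
    SymbolUpTo n m (fun x => conj (f x)) := by
  have key : ∀ {m : ℕ} {f : Plane → ℂ}, (f =O[cobounded Plane] fun x => ‖x‖⁻¹ ^ m) →
      (fun x => (starRingEnd ℂ) (f x)) =O[cobounded Plane] fun x => ‖x‖⁻¹ ^ m := by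
    intro m f h
    refine IsBigO.trans (IsBigO.of_norm_left ?_) h
    simpa using isBigO_refl (fun x => ‖f x‖) _ |>.norm_left.of_norm_right
  induction n generalizing m f with
  | zero => exact key h
  | succ n ih =>
    refine ⟨key h.1, fun μ => ?_⟩
    rw [pd_conj hf]
    exact ih (contDiff_pd hf μ) (h.2 μ)

/-- Division by a symbol of order zero which is bounded away from zero. -/
lemma of_mul (hf : ContDiff ℝ ∞ f) (hg : ContDiff ℝ ∞ g) {c : ℝ} (hc : 0 < c)
    (hlow : ∀ᶠ x in cobounded Plane, c ≤ ‖g x‖) (hgs : ∀ n, SymbolUpTo n 0 g)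
    (h : SymbolUpTo n m (f * g)) : SymbolUpTo n m f := by
  have key : ∀ {m : ℕ} {f : Plane → ℂ}, ((f * g) =O[cobounded Plane] fun x => ‖x‖⁻¹ ^ m) →
      f =O[cobounded Plane] fun x => ‖x‖⁻¹ ^ m := by
    intro m f h
    refine IsBigO.trans (IsBigO.of_bound c⁻¹ ?_) h
    filter_upwards [hlow] with x hx
    rw [Pi.mul_apply, norm_mul, inv_mul_eq_div, le_div_iff₀ hc]
    gcongr
  induction n generalizing m f with
  | zero => exact key h
  | succ n ih =>
    refine ⟨key h.1, fun μ => ih (contDiff_pd hf μ) ?_⟩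
    -- A quotient rule without quotients: `f ∂g` is controlled because `∂g` has order 1 and the
    -- induction hypothesis already applies to `f` itself.
    have e : pd μ f * g = pd μ (f * g) + -(f * pd μ g) := by
      rw [pd_mul hf hg]; ring
    rw [e]
    have hgμ : SymbolUpTo n 1 (pd μ g) := by simpa using (hgs (n + 1)).2 μ
    exact add (contDiff_pd (hf.mul hg) μ) (hf.mul (contDiff_pd hg μ)).neg (h.2 μ)
      (mul hf (contDiff_pd hg μ) (ih hf h.of_succ) hgμ).neg

end SymbolUpTo

/-- Smooth functions whose derivatives of order `j` are `O(r^{-(m + j)})` for all `j`. -/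
structure IsSymbol (m : ℕ) (f : Plane → ℂ) : Prop where
  smooth : ContDiff ℝ ∞ f
  bound : ∀ n, SymbolUpTo n m f

namespace IsSymbol

variable {m k : ℕ} {f g : Plane → ℂ}

lemma isBigO (h : IsSymbol m f) : f =O[cobounded Plane] fun x => ‖x‖⁻¹ ^ m := h.bound 0

lemma mono (h : IsSymbol k f) (hmk : m ≤ k) : IsSymbol m f :=
  ⟨h.smooth, fun n => (h.bound n).mono hmk⟩

lemma add (h : IsSymbol m f) (h' : IsSymbol m g) : IsSymbol m (f + g) :=
  ⟨h.smooth.add h'.smooth, fun n => (h.bound n).add h.smooth h'.smooth (h'.bound n)⟩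

lemma neg (h : IsSymbol m f) : IsSymbol m (-f) := ⟨h.smooth.neg, fun n => (h.bound n).neg⟩

lemma sub (h : IsSymbol m f) (h' : IsSymbol m g) : IsSymbol m (f - g) := by
  rw [sub_eq_add_neg]
  exact h.add h'.neg

lemma mul (h : IsSymbol m f) (h' : IsSymbol k g) : IsSymbol (m + k) (f * g) :=
  ⟨h.smooth.mul h'.smooth, fun n => (h.bound n).mul h.smooth h'.smooth (h'.bound n)⟩

lemma pd (h : IsSymbol m f) (μ : Fin 2) : IsSymbol (m + 1) (pd μ f) :=
  ⟨contDiff_pd h.smooth μ, fun n => (h.bound (n + 1)).2 μ⟩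

lemma conjugate (h : IsSymbol m f) : IsSymbol m (fun x => conj (f x)) :=
  ⟨contDiff_conj h.smooth, fun n => (h.bound n).conjugate h.smooth⟩

lemma zero : IsSymbol m 0 := by
  refine ⟨contDiff_const, fun n => ?_⟩
  induction n generalizing m with
  | zero => exact isBigO_zero _ _
  | succ n ih =>
    refine ⟨isBigO_zero _ _, fun μ => ?_⟩
    have : NCVortex.pd μ (0 : Plane → ℂ) = 0 := pd_const 0 μ
    rw [this]
    exact ih

lemma const (c : ℂ) : IsSymbol 0 (fun _ => c) := by
  have hb : (fun _ : Plane => c) =O[cobounded Plane] fun x => ‖x‖⁻¹ ^ 0 := by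
    simpa using isBigO_const_const c (one_ne_zero (α := ℝ)) _
  refine ⟨contDiff_const, fun n => ?_⟩
  cases n with
  | zero => exact hb
  | succ n =>
    refine ⟨hb, fun μ => ?_⟩
    rw [pd_const]
    exact zero.bound n

lemma const_mul (c : ℂ) (h : IsSymbol m f) : IsSymbol m ((fun _ => c) * f) := by
  simpa using (const c).mul h

lemma sum {ι : Type*} (s : Finset ι) (F : ι → Plane → ℂ) (hF : ∀ i ∈ s, IsSymbol m (F i)) :
    IsSymbol m (∑ i ∈ s, F i) := by
  classical
  induction s using Finset.induction_on with
  | empty => simpa using zero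
  | insert i s hi ih =>
    rw [Finset.sum_insert hi]
    exact (hF i (by simp)).add (ih fun j hj => hF j (by simp [hj]))

lemma of_mul (hf : ContDiff ℝ ∞ f) (hg : IsSymbol 0 g) {c : ℝ} (hc : 0 < c)
    (hlow : ∀ᶠ x in cobounded Plane, c ≤ ‖g x‖) (h : IsSymbol m (f * g)) : IsSymbol m f :=
  ⟨hf, fun n => (h.bound n).of_mul hf hg.smooth hc hlow hg.bound⟩

end IsSymbol

/-! ### From bounds on iterated Fréchet derivatives to symbols. -/

lemma norm_single_one (μ : Fin 2) : ‖(EuclideanSpace.single μ 1 : Plane)‖ = 1 := by simp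

lemma norm_pd_le (f : Plane → ℂ) (μ : Fin 2) (x : Plane) : ‖pd μ f x‖ ≤ ‖fderiv ℝ f x‖ := by
  simpa [norm_single_one, pd] using (fderiv ℝ f x).le_opNorm (EuclideanSpace.single μ 1)

/-- A partial derivative is `fderiv` followed by evaluation at a unit vector, a map of norm at most
one. So the `j`-th derivative of `pd μ f` is bounded by the `(j+1)`-st of `f`. -/
lemma symbolUpTo_of_iteratedFDeriv {f : Plane → ℂ} {m : ℕ} (n : ℕ) (hf : ContDiff ℝ ∞ f)
    (h : ∀ j, iteratedFDeriv ℝ j f =O[cobounded Plane] fun x => ‖x‖⁻¹ ^ (m + j)) :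
    SymbolUpTo n m f := by
  have h0 : f =O[cobounded Plane] fun x => ‖x‖⁻¹ ^ m := by
    refine IsBigO.of_norm_left ?_
    simpa using (h 0).norm_left
  induction n generalizing m f with
  | zero => exact h0
  | succ n ih =>
    refine ⟨h0, fun μ => ?_⟩
    have h1 : ∀ j, iteratedFDeriv ℝ j (pd μ f) =O[cobounded Plane]
        fun x => ‖x‖⁻¹ ^ (m + 1 + j) := by
      intro j
      have hj := h (j + 1)
      rw [show m + (j + 1) = m + 1 + j by ring] at hj
      refine IsBigO.trans (IsBigO.of_bound 1 (Eventually.of_forall fun x => ?_)) hj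
      have := (ContinuousLinearMap.apply ℝ ℂ
        (EuclideanSpace.single μ 1 : Plane)).norm_iteratedFDeriv_comp_left
          (f := fderiv ℝ f) (x := x) (n := j) (N := ∞)
          (hf.fderiv_right (m := ∞) (by simp)).contDiffAt (by exact_mod_cast le_top)
      rw [norm_iteratedFDeriv_fderiv] at this
      refine this.trans ?_
      gcongr
      refine ContinuousLinearMap.opNorm_le_bound _ zero_le_one fun L => ?_
      simpa [norm_single_one, mul_comm] using L.le_opNorm (EuclideanSpace.single μ 1)
    refine ih (contDiff_pd hf μ) h1 (IsBigO.of_norm_left ?_)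
    simpa using (h1 0).norm_left

lemma TameAtInfinity.isSymbol {f : Plane → ℂ} (h : TameAtInfinity f) (hf : ContDiff ℝ ∞ f) :
    IsSymbol 0 f := by
  refine ⟨hf, fun n => symbolUpTo_of_iteratedFDeriv n hf fun j => ?_⟩
  obtain ⟨C, R, hC⟩ := h j
  refine IsBigO.of_bound C ?_
  filter_upwards [eventually_cobounded_le_norm (E := Plane) (R + 1)] with x hx
  refine (hC x (by linarith)).trans_eq ?_
  rw [norm_pow, norm_inv, norm_norm, zero_add, Real.rpow_neg (norm_nonneg _), Real.rpow_natCast,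
    inv_pow]

/-! ### The operators `∂` and `∂̄`. -/

section ComplexDerivatives

variable {m : ℕ} {f g : Plane → ℂ}

lemma dz_eq (f : Plane → ℂ) :
    dz f = (fun _ => (Real.sqrt 2 : ℂ)⁻¹) * (pd 0 f - (fun _ => Complex.I) * pd 1 f) := by
  funext x
  simp only [dz, Pi.mul_apply, Pi.sub_apply]
  ring

lemma dzbar_eq (f : Plane → ℂ) :
    dzbar f = (fun _ => (Real.sqrt 2 : ℂ)⁻¹) * (pd 0 f + (fun _ => Complex.I) * pd 1 f) := by
  funext x
  simp only [dzbar, Pi.mul_apply, Pi.add_apply]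
  ring

lemma IsSymbol.dz (h : IsSymbol m f) : IsSymbol (m + 1) (dz f) := by
  rw [dz_eq]
  exact ((h.pd 0).sub ((h.pd 1).const_mul _)).const_mul _

lemma IsSymbol.dzbar (h : IsSymbol m f) : IsSymbol (m + 1) (dzbar f) := by
  rw [dzbar_eq]
  exact ((h.pd 0).add ((h.pd 1).const_mul _)).const_mul _

lemma dz_add (hf : ContDiff ℝ ∞ f) (hg : ContDiff ℝ ∞ g) : dz (f + g) = dz f + dz g := by
  simp only [dz_eq, pd_add hf hg]
  ring

lemma dzbar_add (hf : ContDiff ℝ ∞ f) (hg : ContDiff ℝ ∞ g) :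
    dzbar (f + g) = dzbar f + dzbar g := by
  simp only [dzbar_eq, pd_add hf hg]
  ring

lemma dz_mul (hf : ContDiff ℝ ∞ f) (hg : ContDiff ℝ ∞ g) :
    dz (f * g) = dz f * g + f * dz g := by
  simp only [dz_eq, pd_mul hf hg]
  ring

lemma dzbar_mul (hf : ContDiff ℝ ∞ f) (hg : ContDiff ℝ ∞ g) :
    dzbar (f * g) = dzbar f * g + f * dzbar g := by
  simp only [dzbar_eq, pd_mul hf hg]
  ring

lemma dz_const (c : ℂ) : dz (fun _ => c) = 0 := by
  simp [dz_eq, pd_const]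

lemma dzbar_const (c : ℂ) : dzbar (fun _ => c) = 0 := by
  simp [dzbar_eq, pd_const]

lemma dz_sum {ι : Type*} (s : Finset ι) (F : ι → Plane → ℂ) (hF : ∀ i ∈ s, ContDiff ℝ ∞ (F i)) :
    dz (∑ i ∈ s, F i) = ∑ i ∈ s, dz (F i) := by
  simp only [dz_eq, pd_sum s F hF, Finset.mul_sum, ← Finset.sum_sub_distrib]

lemma dzbar_sum {ι : Type*} (s : Finset ι) (F : ι → Plane → ℂ)
    (hF : ∀ i ∈ s, ContDiff ℝ ∞ (F i)) : dzbar (∑ i ∈ s, F i) = ∑ i ∈ s, dzbar (F i) := by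
  simp only [dzbar_eq, pd_sum s F hF, Finset.mul_sum, ← Finset.sum_add_distrib]

lemma dzbar_dz (hf : ContDiff ℝ ∞ f) : dzbar (dz f) = dz (dzbar f) := by
  have h0 := contDiff_pd hf 0
  have h1 := contDiff_pd hf 1
  have hI : ContDiff ℝ ∞ ((fun _ => Complex.I) * pd 1 f) := contDiff_const.mul h1
  rw [dz_eq f, dzbar_eq f, dzbar_mul contDiff_const (g := _ - _) (h0.sub hI),
    dz_mul contDiff_const (g := _ + _) (h0.add hI),
    dzbar_const, dz_const, zero_mul, zero_mul, zero_add, zero_add]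
  congr 1
  rw [dz_eq, dzbar_eq]
  simp only [pd_sub h0 hI, pd_add h0 hI, pd_const_mul h1, pd_comm hf 1 0]
  ring

end ComplexDerivatives

/-! ### Splitting the Moyal product into a commutative product and a tail. -/

/-- The terms with at least one derivative on each factor of the Moyal product. -/
def moyalTail (f g : FormalField) : FormalField :=
  fun k => moyal f g k - PowerSeries.coeff k (PowerSeries.mk f * PowerSeries.mk g)

lemma moyal_eq (f g : FormalField) (k : ℕ) :
    moyal f g k = PowerSeries.coeff k (PowerSeries.mk f * PowerSeries.mk g) + moyalTail f g k := by
  simp [moyalTail]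

lemma moyalTail_zero (f g : FormalField) : moyalTail f g 0 = 0 := by
  funext x
  simp [moyalTail, moyal, bidiff, PowerSeries.coeff_mul]

lemma moyalTail_succ (f g : FormalField) (k : ℕ) :
    moyalTail f g (k + 1) = ∑ p ∈ Finset.HasAntidiagonal.antidiagonal k,
      ∑ q ∈ Finset.HasAntidiagonal.antidiagonal p.1,
      (fun _ => (Complex.I / 2) ^ (p.2 + 1) / ((p.2 + 1).factorial : ℂ)) *
        bidiff (p.2 + 1) (f q.1) (g q.2) := by
  funext x
  have h0 : PowerSeries.coeff (k + 1) (PowerSeries.mk f * PowerSeries.mk g) x =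
      ∑ q ∈ Finset.HasAntidiagonal.antidiagonal (k + 1),
        (Complex.I / 2) ^ 0 / (Nat.factorial 0 : ℂ) * bidiff 0 (f q.1) (g q.2) x := by
    simp [PowerSeries.coeff_mul, bidiff]
  rw [moyalTail, Pi.sub_apply, h0, moyal, Finset.Nat.sum_antidiagonal_succ', add_sub_cancel_left]
  simp [Finset.sum_apply]

lemma contDiff_bidiff {f g : Plane → ℂ} (hf : ContDiff ℝ ∞ f) (hg : ContDiff ℝ ∞ g) (n : ℕ) :
    ContDiff ℝ ∞ (bidiff n f g) := by
  induction n generalizing f g with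
  | zero => exact hf.mul hg
  | succ n ih =>
    exact (ih (contDiff_pd hf 0) (contDiff_pd hg 1)).sub (ih (contDiff_pd hf 1) (contDiff_pd hg 0))

/-- Each application of the bidifferential operator differentiates both factors once. -/
lemma IsSymbol.bidiff {m k : ℕ} {f g : Plane → ℂ} (hf : IsSymbol m f) (hg : IsSymbol k g)
    (n : ℕ) : IsSymbol (m + k + 2 * n) (bidiff n f g) := by
  induction n generalizing f g m k with
  | zero => exact hf.mul hg
  | succ n ih =>
    exact ((ih (hf.pd 0) (hg.pd 1)).mono (by omega)).sub
      ((ih (hf.pd 1) (hg.pd 0)).mono (by omega))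

/-- Every tail term spends at least one power of `θ` on derivatives, so only coefficients of index
below `k` occur. This strictness is what allows inductions on the order in `θ`. -/
lemma isSymbol_moyalTail {m l k : ℕ} {f g : FormalField} (hf : ∀ j < k, IsSymbol m (f j))
    (hg : ∀ j < k, IsSymbol l (g j)) : IsSymbol (m + l + 2) (moyalTail f g k) := by
  cases k with
  | zero =>
    rw [moyalTail_zero]
    exact IsSymbol.zero
  | succ k =>
    rw [moyalTail_succ]
    refine IsSymbol.sum _ _ fun p hp => IsSymbol.sum _ _ fun q hq => IsSymbol.const_mul _ ?_
    rw [Finset.HasAntidiagonal.mem_antidiagonal] at hp hq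
    exact ((hf q.1 (by omega)).bidiff (hg q.2 (by omega)) (p.2 + 1)).mono (by omega)

/-! ### Power series with symbol coefficients, and division. -/

/-- Formal power series in `θ` all of whose coefficients are symbols. -/
def IsSymbolSeries (m : ℕ) (F : PowerSeries (Plane → ℂ)) : Prop :=
  ∀ k, IsSymbol m (PowerSeries.coeff k F)

namespace IsSymbolSeries

variable {m k : ℕ} {F G : PowerSeries (Plane → ℂ)}

lemma mono (h : IsSymbolSeries k F) (hmk : m ≤ k) : IsSymbolSeries m F := fun j => (h j).mono hmk

lemma add (h : IsSymbolSeries m F) (h' : IsSymbolSeries m G) : IsSymbolSeries m (F + G) :=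
  fun j => by simpa using (h j).add (h' j)

lemma neg (h : IsSymbolSeries m F) : IsSymbolSeries m (-F) :=
  fun j => by simpa using (h j).neg

lemma sub (h : IsSymbolSeries m F) (h' : IsSymbolSeries m G) : IsSymbolSeries m (F - G) :=
  fun j => by simpa using (h j).sub (h' j)

lemma mul (h : IsSymbolSeries m F) (h' : IsSymbolSeries k G) : IsSymbolSeries (m + k) (F * G) := by
  intro j
  rw [PowerSeries.coeff_mul]
  exact IsSymbol.sum _ _ fun p _ => (h p.1).mul (h' p.2)

lemma C_mul (c : ℂ) (h : IsSymbolSeries m F) :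
    IsSymbolSeries m (PowerSeries.C (fun _ => c) * F) :=
  fun j => by simpa using (h j).const_mul c

end IsSymbolSeries

lemma coeff_mul_eq_add_sum_range (F G : PowerSeries (Plane → ℂ)) (k : ℕ) :
    PowerSeries.coeff k (F * G) = PowerSeries.coeff k F * PowerSeries.coeff 0 G +
      ∑ i ∈ Finset.range k, PowerSeries.coeff i F * PowerSeries.coeff (k - i) G := by
  rw [PowerSeries.coeff_mul, Finset.Nat.sum_antidiagonal_eq_sum_range_succ
    (fun i j => PowerSeries.coeff i F * PowerSeries.coeff j G), Finset.sum_range_succ,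
    Nat.sub_self, add_comm]

section Division

variable {m k : ℕ} {F G : PowerSeries (Plane → ℂ)} {c : ℝ}

/-- `F_k G_0` is `(FG)_k` minus products containing only `F_j` with `j < k`, and `G_0` can be
divided out at infinity. -/
lemma IsSymbol.coeff_of_mul (hG : IsSymbolSeries 0 G) (hc : 0 < c)
    (hlow : ∀ᶠ x in cobounded Plane, c ≤ ‖PowerSeries.coeff 0 G x‖)
    (hF : ContDiff ℝ ∞ (PowerSeries.coeff k F))
    (hlt : ∀ j < k, IsSymbol m (PowerSeries.coeff j F))
    (h : IsSymbol m (PowerSeries.coeff k (F * G))) : IsSymbol m (PowerSeries.coeff k F) := by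
  refine IsSymbol.of_mul hF (hG 0) hc hlow ?_
  have e := coeff_mul_eq_add_sum_range F G k
  rw [← sub_eq_iff_eq_add] at e
  rw [← e]
  exact h.sub (IsSymbol.sum _ _ fun i hi => (hlt i (Finset.mem_range.1 hi)).mul (hG _))

lemma IsSymbolSeries.of_mul (hG : IsSymbolSeries 0 G) (hc : 0 < c)
    (hlow : ∀ᶠ x in cobounded Plane, c ≤ ‖PowerSeries.coeff 0 G x‖)
    (hF : ∀ k, ContDiff ℝ ∞ (PowerSeries.coeff k F))
    (h : IsSymbolSeries m (F * G)) : IsSymbolSeries m F := by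
  intro k
  induction k using Nat.strong_induction_on with
  | _ k ih => exact IsSymbol.coeff_of_mul hG hc hlow (hF k) ih (h k)

end Division

/-- `∂` on formal power series, coefficientwise. -/
def seriesDz (F : PowerSeries (Plane → ℂ)) : PowerSeries (Plane → ℂ) :=
  PowerSeries.mk fun k => dz (PowerSeries.coeff k F)

/-- `∂̄` on formal power series, coefficientwise. -/
def seriesDzbar (F : PowerSeries (Plane → ℂ)) : PowerSeries (Plane → ℂ) :=
  PowerSeries.mk fun k => dzbar (PowerSeries.coeff k F)

section SeriesDerivatives

variable {m k : ℕ} {F G : PowerSeries (Plane → ℂ)}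

lemma IsSymbolSeries.dz (h : IsSymbolSeries m F) : IsSymbolSeries (m + 1) (seriesDz F) :=
  fun j => by simpa [seriesDz] using (h j).dz

lemma IsSymbolSeries.dzbar (h : IsSymbolSeries m F) : IsSymbolSeries (m + 1) (seriesDzbar F) :=
  fun j => by simpa [seriesDzbar] using (h j).dzbar

lemma seriesDz_add (hF : IsSymbolSeries m F) (hG : IsSymbolSeries k G) :
    seriesDz (F + G) = seriesDz F + seriesDz G := by
  ext1 j
  simp [seriesDz, dz_add (hF j).smooth (hG j).smooth]

lemma seriesDzbar_add (hF : IsSymbolSeries m F) (hG : IsSymbolSeries k G) :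
    seriesDzbar (F + G) = seriesDzbar F + seriesDzbar G := by
  ext1 j
  simp [seriesDzbar, dzbar_add (hF j).smooth (hG j).smooth]

lemma seriesDz_mul (hF : IsSymbolSeries m F) (hG : IsSymbolSeries k G) :
    seriesDz (F * G) = seriesDz F * G + F * seriesDz G := by
  ext1 j
  simp only [seriesDz, PowerSeries.coeff_mk, PowerSeries.coeff_mul, map_add]
  rw [dz_sum _ _ fun p _ => (hF p.1).smooth.mul (hG p.2).smooth, ← Finset.sum_add_distrib]
  exact Finset.sum_congr rfl fun p _ => dz_mul (hF p.1).smooth (hG p.2).smooth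

lemma seriesDzbar_mul (hF : IsSymbolSeries m F) (hG : IsSymbolSeries k G) :
    seriesDzbar (F * G) = seriesDzbar F * G + F * seriesDzbar G := by
  ext1 j
  simp only [seriesDzbar, PowerSeries.coeff_mk, PowerSeries.coeff_mul, map_add]
  rw [dzbar_sum _ _ fun p _ => (hF p.1).smooth.mul (hG p.2).smooth, ← Finset.sum_add_distrib]
  exact Finset.sum_congr rfl fun p _ => dzbar_mul (hF p.1).smooth (hG p.2).smooth

lemma isSymbolSeries_C (c : ℂ) : IsSymbolSeries 0 (PowerSeries.C (fun _ => c)) := by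
  intro j
  rw [PowerSeries.coeff_C]
  split_ifs
  · exact IsSymbol.const c
  · exact IsSymbol.zero

lemma seriesDz_C (c : ℂ) : seriesDz (PowerSeries.C (fun _ => c)) = 0 := by
  ext1 j
  rw [seriesDz, PowerSeries.coeff_mk, PowerSeries.coeff_C]
  split_ifs
  · exact dz_const c
  · exact dz_const 0

lemma seriesDzbar_C (c : ℂ) : seriesDzbar (PowerSeries.C (fun _ => c)) = 0 := by
  ext1 j
  rw [seriesDzbar, PowerSeries.coeff_mk, PowerSeries.coeff_C]
  split_ifs
  · exact dzbar_const c
  · exact dzbar_const 0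

lemma seriesDz_C_mul (c : ℂ) (hF : IsSymbolSeries m F) :
    seriesDz (PowerSeries.C (fun _ => c) * F) = PowerSeries.C (fun _ => c) * seriesDz F := by
  rw [seriesDz_mul (isSymbolSeries_C c) hF, seriesDz_C, zero_mul, zero_add]

lemma seriesDzbar_C_mul (c : ℂ) (hF : IsSymbolSeries m F) :
    seriesDzbar (PowerSeries.C (fun _ => c) * F) = PowerSeries.C (fun _ => c) * seriesDzbar F := by
  rw [seriesDzbar_mul (isSymbolSeries_C c) hF, seriesDzbar_C, zero_mul, zero_add]

lemma seriesDzbar_dz (hF : IsSymbolSeries m F) :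
    seriesDzbar (seriesDz F) = seriesDz (seriesDzbar F) := by
  ext1 j
  simp [seriesDz, seriesDzbar, dzbar_dz (hF j).smooth]

end SeriesDerivatives

/-! ### Estimates at infinity: lower bounds, vanishing symbols, integrability. -/

lemma norm_le_of_norm_single_le (L : Plane →L[ℝ] ℂ) {c : ℝ}
    (h : ∀ μ, ‖L (EuclideanSpace.single μ 1)‖ ≤ c) : ‖L‖ ≤ 2 * c := by
  have hc : 0 ≤ c := (norm_nonneg _).trans (h 0)
  refine L.opNorm_le_bound (by positivity) fun v => ?_
  have hv : v = v 0 • EuclideanSpace.single 0 1 + v 1 • EuclideanSpace.single 1 1 := by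
    ext i
    fin_cases i <;> simp
  have hcoord : ∀ μ, ‖L (v μ • EuclideanSpace.single μ 1)‖ ≤ ‖v‖ * c := by
    intro μ
    rw [map_smul, norm_smul]
    gcongr
    · exact PiLp.norm_apply_le v μ
    · exact h μ
  calc ‖L v‖ = ‖L (v 0 • EuclideanSpace.single 0 1) + L (v 1 • EuclideanSpace.single 1 1)‖ := by
        rw [← map_add, ← hv]
    _ ≤ ‖v‖ * c + ‖v‖ * c := (norm_add_le _ _).trans (add_le_add (hcoord 0) (hcoord 1))
    _ = 2 * c * ‖v‖ := by ring

lemma half_norm_le_of_norm_sub_le {x y : Plane} (h : ‖y - x‖ ≤ ‖x‖ / 2) : ‖x‖ / 2 ≤ ‖y‖ := by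
  have := norm_sub_norm_le x y
  rw [norm_sub_rev] at this
  linarith

lemma exists_bound_of_isBigO {m : ℕ} {f : Plane → ℂ}
    (h : f =O[cobounded Plane] fun x => ‖x‖⁻¹ ^ m) :
    ∃ C R : ℝ, 0 < C ∧ 0 < R ∧ ∀ x, R ≤ ‖x‖ → ‖f x‖ ≤ C * ‖x‖⁻¹ ^ m := by
  obtain ⟨C, hC, h⟩ := h.exists_pos
  obtain ⟨R, -, hR⟩ := hasBasis_cobounded_norm.eventually_iff.1 h.bound
  refine ⟨C, max R 1, hC, by positivity, fun x hx => ?_⟩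
  simpa using hR (show R ≤ ‖x‖ from (le_max_left _ _).trans hx)

/-- Mean value inequality on the ball of radius `‖x‖ / 2` about `x`: its points have norm at least
`‖x‖ / 2`, so replacing their norm by `‖x‖` in the gradient bound costs only `2 ^ (m + 1)`. -/
lemma IsSymbol.exists_lipschitz {m : ℕ} {f : Plane → ℂ} (h : IsSymbol m f) :
    ∃ C R : ℝ, 0 < C ∧ 0 < R ∧ ∀ x, R ≤ ‖x‖ → ∀ y, ‖y - x‖ ≤ ‖x‖ / 2 →
      ‖f y - f x‖ ≤ C * ‖x‖⁻¹ ^ (m + 1) * ‖y - x‖ := by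
  obtain ⟨C₀, R₀, hC₀, hR₀, h₀⟩ := exists_bound_of_isBigO (h.pd 0).isBigO
  obtain ⟨C₁, R₁, hC₁, hR₁, h₁⟩ := exists_bound_of_isBigO (h.pd 1).isBigO
  refine ⟨2 * ((C₀ + C₁) * 2 ^ (m + 1)), 2 * (R₀ + R₁), by positivity, by positivity,
    fun x hx y hy => ?_⟩
  have hx0 : 0 < ‖x‖ := by linarith
  refine (convex_closedBall x (‖x‖ / 2)).norm_image_sub_le_of_norm_fderiv_le (𝕜 := ℝ)
    (fun z _ => h.smooth.differentiable (by simp) z) (fun z hz => ?_)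
    (Metric.mem_closedBall_self (by positivity)) (by simpa [dist_eq_norm] using hy)
  have hz' : ‖x‖ / 2 ≤ ‖z‖ :=
    half_norm_le_of_norm_sub_le (by simpa [dist_eq_norm] using hz)
  have hinv : ‖z‖⁻¹ ^ (m + 1) ≤ 2 ^ (m + 1) * ‖x‖⁻¹ ^ (m + 1) := by
    rw [← mul_pow]
    gcongr
    calc ‖z‖⁻¹ ≤ (‖x‖ / 2)⁻¹ := by gcongr
      _ = 2 * ‖x‖⁻¹ := by rw [inv_div, div_eq_mul_inv]
  have hb : ∀ μ, ‖fderiv ℝ f z (EuclideanSpace.single μ 1)‖ ≤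
      (C₀ + C₁) * (2 ^ (m + 1) * ‖x‖⁻¹ ^ (m + 1)) := by
    intro μ
    fin_cases μ
    · refine (h₀ z (by linarith)).trans ?_
      gcongr
      linarith
    · refine (h₁ z (by linarith)).trans ?_
      gcongr
      linarith
  refine (norm_le_of_norm_single_le _ hb).trans_eq ?_
  ring

/-- If `1 - |f|²` is integrable and `∇f = O(1 / r)`, then `f` is bounded away from zero. -/
lemma IsSymbol.eventually_half_le_norm {f : Plane → ℂ} (h : IsSymbol 0 f)
    (hint : Integrable fun x => 1 - ‖f x‖ ^ 2) : ∀ᶠ x in cobounded Plane, 1 / 2 ≤ ‖f x‖ := by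
  obtain ⟨C, R, hC, hR, hlip⟩ := h.exists_lipschitz
  set M : ℝ := ∫ x, ‖1 - ‖f x‖ ^ 2‖ with hM
  -- With this `δ`, `f` varies by at most `1/4` on the ball of radius `δ‖x‖`. If `‖f x‖ < 1/2`, then
  -- `‖f‖ ≤ 3/4` and `1 - ‖f‖² ≥ 1/4` on that ball; Markov bounds its area by `4M`, which fails for
  -- large `‖x‖`.
  set δ : ℝ := min (1 / 2) (1 / (4 * C)) with hδ
  have hδ0 : 0 < δ := by positivity
  set v : ℝ := volume.real (Metric.ball (0 : Plane) 1) with hv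
  have hv0 : 0 < v := by
    rw [hv, measureReal_def]
    exact ENNReal.toReal_pos (Metric.measure_ball_pos _ _ one_pos).ne' measure_ball_lt_top.ne
  have hlarge : ∀ᶠ x in cobounded Plane, 4 * M / (δ ^ 2 * v) < ‖x‖ ^ 2 :=
    ((tendsto_pow_atTop two_ne_zero).comp tendsto_norm_cobounded_atTop).eventually_gt_atTop _
  filter_upwards [hlarge, eventually_cobounded_le_norm (E := Plane) R] with x hx hxR
  by_contra! hlt
  have hx0 : 0 < ‖x‖ := hR.trans_le hxR
  have hsub : Metric.ball x (δ * ‖x‖) ⊆ {y | 1 / 4 ≤ ‖1 - ‖f y‖ ^ 2‖} := by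
    intro y hy
    rw [Metric.mem_ball, dist_eq_norm] at hy
    have h2 : ‖y - x‖ ≤ ‖x‖ / 2 := by
      have : δ * ‖x‖ ≤ 1 / 2 * ‖x‖ := by gcongr; exact min_le_left _ _
      linarith
    have h3 : ‖f y - f x‖ ≤ 1 / 4 := by
      calc ‖f y - f x‖ ≤ C * ‖x‖⁻¹ ^ (0 + 1) * ‖y - x‖ := hlip x hxR y h2
        _ ≤ C * ‖x‖⁻¹ ^ (0 + 1) * (1 / (4 * C) * ‖x‖) := by
          gcongr
          exact hy.le.trans (by gcongr; exact min_le_right _ _)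
        _ = 1 / 4 := by rw [zero_add, pow_one]; field_simp
    have h4 : ‖f y‖ ≤ 3 / 4 := by
      have := norm_le_norm_add_norm_sub' (f y) (f x)
      linarith
    have h5 : ‖f y‖ ^ 2 ≤ (3 / 4) ^ 2 := by gcongr
    refine le_trans ?_ (Real.le_norm_self _)
    linarith
  have hmarkov := mul_meas_ge_le_integral_of_nonneg (μ := volume)
    (f := fun x => ‖1 - ‖f x‖ ^ 2‖) (Eventually.of_forall fun x => norm_nonneg _) hint.norm (1 / 4)
  have hvol : volume.real (Metric.ball x (δ * ‖x‖)) = (δ * ‖x‖) ^ 2 * v := by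
    rw [← Measure.addHaar_real_closedBall_eq_addHaar_real_ball,
      Measure.addHaar_real_closedBall _ _ (by positivity)]
    simp [hv]
  have hmono := measureReal_mono hsub (hint.measure_norm_ge_lt_top (by norm_num)).ne
  rw [hvol] at hmono
  rw [div_lt_iff₀ (by positivity)] at hx
  nlinarith

/-- A vanishing symbol of order zero has gradient `o(1 / r)`. -/
lemma isLittleO_pd_of_tendsto_zero {f : Plane → ℂ} (h : IsSymbol 0 f)
    (h0 : Tendsto f (cobounded Plane) (𝓝 0)) (μ : Fin 2) :
    pd μ f =o[cobounded Plane] fun x => ‖x‖⁻¹ := by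
  obtain ⟨C₀, R₀, hC₀, hR₀, hlip₀⟩ := (h.pd 0).exists_lipschitz
  obtain ⟨C₁, R₁, hC₁, hR₁, hlip₁⟩ := (h.pd 1).exists_lipschitz
  rw [isLittleO_iff]
  intro ε hε
  set C := 2 * (C₀ + C₁) with hC
  have hC0 : 0 < C := by positivity
  -- Taylor's formula with step `t = δ‖x‖` gives `t |∂f(x)| ≤ |f(x + te)| + |f(x)| + C‖x‖⁻² t²`.
  -- Hence `‖x‖ |∂f(x)|` is at most `(|f(x + te)| + |f(x)|)/δ + Cδ`, and each summand is made at
  -- most `ε/2`.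
  set δ : ℝ := min (1 / 2) (ε / (2 * C)) with hδ
  have hδ0 : 0 < δ := by positivity
  have hδh : δ ≤ 1 / 2 := min_le_left _ _
  have hCδ : C * δ ≤ ε / 2 := by
    calc C * δ ≤ C * (ε / (2 * C)) := by gcongr; exact min_le_right _ _
      _ = ε / 2 := by field_simp
  obtain ⟨R, -, hsmall⟩ := hasBasis_cobounded_norm.eventually_iff.1
    ((tendsto_zero_iff_norm_tendsto_zero.1 h0).eventually_le_const
      (show (0 : ℝ) < ε * δ / 4 by positivity))
  filter_upwards [eventually_cobounded_le_norm (E := Plane) (R₀ + R₁ + 2 * |R|)] with x hx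
  have hRabs := le_abs_self R
  have hRn := abs_nonneg R
  have hx0 : 0 < ‖x‖ := by linarith
  set e : Plane := EuclideanSpace.single μ 1 with he
  have hen : ‖e‖ = 1 := norm_single_one μ
  set t : ℝ := δ * ‖x‖ with ht
  have ht0 : 0 < t := by positivity
  have ht2 : t ≤ ‖x‖ / 2 := by rw [ht]; nlinarith
  have hyx : ‖(x + t • e) - x‖ = t := by
    rw [add_sub_cancel_left, norm_smul, hen, mul_one, Real.norm_of_nonneg ht0.le]
  have hy2 : ‖x‖ / 2 ≤ ‖x + t • e‖ := half_norm_le_of_norm_sub_le (by rw [hyx]; exact ht2)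
  have hfy : ‖f (x + t • e)‖ ≤ ε * δ / 4 := hsmall (show R ≤ ‖x + t • e‖ by linarith)
  have hfx : ‖f x‖ ≤ ε * δ / 4 := hsmall (show R ≤ ‖x‖ by linarith)
  have htaylor := (convex_closedBall x t).norm_image_sub_le_of_norm_fderiv_le' (𝕜 := ℝ)
    (f := f) (φ := fderiv ℝ f x) (C := C * ‖x‖⁻¹ ^ 2 * t) (y := x + t • e)
    (fun z _ => h.smooth.differentiable (by simp) z)
    (fun z hz => by
      rw [Metric.mem_closedBall, dist_eq_norm] at hz
      have hb : ∀ ν, ‖(fderiv ℝ f z - fderiv ℝ f x) (EuclideanSpace.single ν 1)‖ ≤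
          (C₀ + C₁) * ‖x‖⁻¹ ^ 2 * t := by
        intro ν
        fin_cases ν
        · refine (hlip₀ x (by linarith) z (hz.trans ht2)).trans ?_
          gcongr
          linarith
        · refine (hlip₁ x (by linarith) z (hz.trans ht2)).trans ?_
          gcongr
          linarith
      refine (norm_le_of_norm_single_le _ hb).trans_eq ?_
      rw [hC]
      ring)
    (Metric.mem_closedBall_self ht0.le) (by rw [Metric.mem_closedBall, dist_eq_norm, hyx])
  rw [hyx, add_sub_cancel_left, map_smul] at htaylor
  change ‖f (x + t • e) - f x - t • pd μ f x‖ ≤ _ at htaylor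
  have htp : ‖t • pd μ f x‖ ≤ ε * δ / 4 + ε * δ / 4 + C * ‖x‖⁻¹ ^ 2 * t * t := by
    have h1 := norm_sub_norm_le (t • pd μ f x) (f (x + t • e) - f x)
    rw [norm_sub_rev (t • pd μ f x)] at h1
    have h2 := norm_sub_le (f (x + t • e)) (f x)
    linarith
  rw [norm_smul, Real.norm_of_nonneg ht0.le] at htp
  have e1 : C * ‖x‖⁻¹ ^ 2 * t * t = C * δ * δ := by
    rw [ht]
    field_simp
  rw [e1] at htp
  have h3 : t * ‖pd μ f x‖ ≤ δ * ε := by nlinarith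
  rw [norm_inv, norm_norm, ← div_eq_mul_inv, le_div_iff₀ hx0]
  refine le_of_mul_le_mul_left ?_ hδ0
  rw [ht] at h3
  linarith

lemma IsSymbol.integrable {f : Plane → ℂ} (h : IsSymbol 3 f) : Integrable f := by
  have hg : Integrable fun x : Plane => (1 + ‖x‖) ^ (-(3 : ℝ)) :=
    integrable_one_add_norm (by simp; norm_num)
  refine h.smooth.continuous.locallyIntegrable.integrable_of_isBigO_cocompact ?_
    (hg.integrableAtFilter _)
  rw [← Metric.cobounded_eq_cocompact]
  -- `8 = 2³`, from `1 + ‖x‖ ≤ 2‖x‖` for `‖x‖ ≥ 1`.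
  refine h.isBigO.trans (IsBigO.of_bound 8 ?_)
  filter_upwards [eventually_cobounded_le_norm (E := Plane) 1] with x hx
  have hx0 : 0 < ‖x‖ := by linarith
  rw [norm_pow, norm_inv, norm_norm, Real.norm_of_nonneg (by positivity),
    Real.rpow_neg (by positivity), show (3 : ℝ) = ((3 : ℕ) : ℝ) by norm_num, Real.rpow_natCast,
    ← inv_pow, show (8 : ℝ) = 2 ^ 3 by norm_num, ← mul_pow]
  gcongr
  rw [← div_eq_mul_inv, le_div_iff₀ (by positivity), inv_mul_le_iff₀ hx0]
  linarith

/-! ### Cutoffs and the divergence theorem on the whole plane. -/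

/-- Smooth cutoffs, equal to one on the ball of radius `n + 1` and supported in the ball of radius
`2 (n + 1)`. -/
def cutoff (n : ℕ) (x : Plane) : ℂ :=
  (((⟨1, 2, one_pos, one_lt_two⟩ : ContDiffBump (0 : Plane)) (((n : ℝ) + 1)⁻¹ • x) : ℝ) : ℂ)

lemma contDiff_cutoff (n : ℕ) : ContDiff ℝ ∞ (cutoff n) :=
  Complex.ofRealCLM.contDiff.comp ((ContDiffBump.contDiff _).comp (contDiff_const_smul _))

lemma cutoff_eq_one {n : ℕ} {x : Plane} (h : ‖x‖ ≤ n + 1) : cutoff n x = 1 := by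
  rw [cutoff, ContDiffBump.one_of_mem_closedBall, Complex.ofReal_one]
  rw [mem_closedBall_zero_iff, norm_smul, norm_inv, Real.norm_of_nonneg (by positivity)]
  exact (inv_mul_le_iff₀ (by positivity)).2 (by simpa using h)

lemma cutoff_eq_zero {n : ℕ} {x : Plane} (h : 2 * ((n : ℝ) + 1) ≤ ‖x‖) : cutoff n x = 0 := by
  rw [cutoff, ContDiffBump.zero_of_le_dist, Complex.ofReal_zero]
  rw [dist_zero_right, norm_smul, norm_inv, Real.norm_of_nonneg (by positivity)]
  exact (le_inv_mul_iff₀ (by positivity)).2 (by linarith)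

lemma norm_cutoff_le (n : ℕ) (x : Plane) : ‖cutoff n x‖ ≤ 1 := by
  rw [cutoff, Complex.norm_real, Real.norm_of_nonneg (ContDiffBump.nonneg _)]
  exact ContDiffBump.le_one _

lemma hasCompactSupport_cutoff (n : ℕ) : HasCompactSupport (cutoff n) := by
  refine HasCompactSupport.of_support_subset_isCompact
    (isCompact_closedBall (0 : Plane) (2 * ((n : ℝ) + 1))) fun x hx => ?_
  rw [mem_closedBall_zero_iff]
  by_contra! hlt
  exact hx (cutoff_eq_zero hlt.le)

/-- All cutoffs are dilations of `cutoff 0`, so the chain rule supplies the factor. -/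
lemma exists_norm_pd_cutoff_le (μ : Fin 2) :
    ∃ K : ℝ, 0 < K ∧ ∀ n x, ‖pd μ (cutoff n) x‖ ≤ K * ((n : ℝ) + 1)⁻¹ := by
  obtain ⟨K, hK⟩ := ((hasCompactSupport_cutoff 0).fderiv (𝕜 := ℝ)).exists_bound_of_continuous
    ((contDiff_cutoff 0).continuous_fderiv (by simp))
  refine ⟨max K 1, by positivity, fun n x => ?_⟩
  have e : cutoff n = fun y => cutoff 0 (((n : ℝ) + 1)⁻¹ • y) := by
    funext y
    simp [cutoff]
  rw [pd, e, fderiv_comp_smul, smul_apply, norm_smul, norm_inv,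
    Real.norm_of_nonneg (by positivity), mul_comm]
  gcongr
  exact (norm_pd_le (cutoff 0) μ _).trans ((hK _).trans (le_max_left _ _))

lemma pd_cutoff_eq_zero_of_lt {n : ℕ} {x : Plane} (h : ‖x‖ < n + 1) (μ : Fin 2) :
    pd μ (cutoff n) x = 0 := by
  have : cutoff n =ᶠ[𝓝 x] fun _ => 1 := by
    filter_upwards [(continuous_norm.tendsto x).eventually_lt_const h] with y hy
    exact cutoff_eq_one hy.le
  rw [pd, this.fderiv_eq]
  simp

lemma pd_cutoff_eq_zero_of_gt {n : ℕ} {x : Plane} (h : 2 * ((n : ℝ) + 1) < ‖x‖) (μ : Fin 2) :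
    pd μ (cutoff n) x = 0 := by
  have : cutoff n =ᶠ[𝓝 x] fun _ => 0 := by
    filter_upwards [(continuous_norm.tendsto x).eventually_const_lt h] with y hy
    exact cutoff_eq_zero hy.le
  rw [pd, this.fderiv_eq]
  simp

/-- The integrand lives on an annulus of radius about `n` and area about `n²`, where the cutoff has
gradient `O(1/n)` and `J = o(1/n)`. -/
lemma tendsto_integral_pd_cutoff_mul {J : Plane → ℂ}
    (h : J =o[cobounded Plane] fun x => ‖x‖⁻¹) (μ : Fin 2) :
    Tendsto (fun n => ∫ x, pd μ (cutoff n) x * J x) atTop (𝓝 0) := by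
  obtain ⟨K, hK, hbound⟩ := exists_norm_pd_cutoff_le μ
  set v : ℝ := volume.real (Metric.ball (0 : Plane) 1) with hv
  rw [Metric.tendsto_atTop]
  intro ε hε
  set η : ℝ := ε / (4 * K * v + 1) with hη
  have hη0 : 0 < η := by positivity
  obtain ⟨R, -, hR⟩ := hasBasis_cobounded_norm.eventually_iff.1 (isLittleO_iff.1 h hη0)
  obtain ⟨N, hN⟩ := exists_nat_ge R
  refine ⟨N, fun n hn => ?_⟩
  set r : ℝ := (n : ℝ) + 1 with hr
  have hr0 : 0 < r := by positivity
  have hRr : R ≤ r := by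
    have : (N : ℝ) ≤ n := by exact_mod_cast hn
    linarith
  have hpt : ∀ x, ‖pd μ (cutoff n) x * J x‖ ≤ K * r⁻¹ * (η * r⁻¹) := by
    intro x
    rcases lt_or_ge ‖x‖ r with hx | hx
    · rw [pd_cutoff_eq_zero_of_lt hx]
      simp only [zero_mul, norm_zero]
      positivity
    · rw [norm_mul]
      have h1 : ‖J x‖ ≤ η * ‖‖x‖⁻¹‖ := hR (show R ≤ ‖x‖ from hRr.trans hx)
      rw [norm_inv, norm_norm] at h1
      gcongr
      · exact hbound n x
      · exact h1.trans (by gcongr)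
  have hset : ∫ x, pd μ (cutoff n) x * J x =
      ∫ x in Metric.closedBall 0 (2 * r), pd μ (cutoff n) x * J x := by
    refine (setIntegral_eq_integral_of_forall_compl_eq_zero fun x hx => ?_).symm
    rw [mem_closedBall_zero_iff, not_le] at hx
    rw [pd_cutoff_eq_zero_of_gt hx, zero_mul]
  have hvol : volume.real (Metric.closedBall (0 : Plane) (2 * r)) = (2 * r) ^ 2 * v := by
    rw [Measure.addHaar_real_closedBall _ _ (by positivity)]
    simp [hv]
  rw [dist_zero_right, hset]
  calc _ ≤ K * r⁻¹ * (η * r⁻¹) * volume.real (Metric.closedBall (0 : Plane) (2 * r)) :=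
        norm_setIntegral_le_of_norm_le_const measure_closedBall_lt_top fun x _ => hpt x
    _ = η * (4 * K * v) := by
        rw [hvol]
        field_simp
        ring
    _ < ε := by
        rw [hη, div_mul_eq_mul_div, div_lt_iff₀ (by positivity)]
        linarith

lemma integral_cutoff_mul_pd {J : Plane → ℂ} (hJ : ContDiff ℝ ∞ J) (n : ℕ) (μ : Fin 2) :
    ∫ x, cutoff n x * pd μ J x = -∫ x, pd μ (cutoff n) x * J x := by
  have hc := contDiff_cutoff n
  have hs := hasCompactSupport_cutoff n
  have hs' : HasCompactSupport (pd μ (cutoff n)) := (hs.fderiv (𝕜 := ℝ)).comp_left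
    (g := fun L : Plane →L[ℝ] ℂ => L (EuclideanSpace.single μ 1)) (by simp)
  refine integral_mul_fderiv_eq_neg_fderiv_mul_of_integrable ?_ ?_ ?_
    (fun x _ => hc.differentiable (by simp) x) (fun x _ => hJ.differentiable (by simp) x)
  · exact ((contDiff_pd hc μ).continuous.mul hJ.continuous).integrable_of_hasCompactSupport
      hs'.mul_right
  · exact (hc.continuous.mul (contDiff_pd hJ μ).continuous).integrable_of_hasCompactSupport
      hs.mul_right
  · exact (hc.continuous.mul hJ.continuous).integrable_of_hasCompactSupport hs.mul_right

/-- `F` is the divergence of a smooth vector field which is `o(1 / r)`. -/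
def HasNullFlux (F : Plane → ℂ) : Prop :=
  ∃ J : Fin 2 → Plane → ℂ, (∀ μ, ContDiff ℝ ∞ (J μ)) ∧
    (∀ μ, J μ =o[cobounded Plane] fun x => ‖x‖⁻¹) ∧ F = pd 0 (J 0) + pd 1 (J 1)

namespace HasNullFlux

variable {F G : Plane → ℂ}

lemma add (hF : HasNullFlux F) (hG : HasNullFlux G) : HasNullFlux (F + G) := by
  obtain ⟨J, hJ, hJo, rfl⟩ := hF
  obtain ⟨K, hK, hKo, rfl⟩ := hG
  refine ⟨fun μ => J μ + K μ, fun μ => (hJ μ).add (hK μ), fun μ => (hJo μ).add (hKo μ), ?_⟩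
  rw [pd_add (hJ 0) (hK 0), pd_add (hJ 1) (hK 1)]
  ring

lemma const_mul (c : ℂ) (hF : HasNullFlux F) : HasNullFlux ((fun _ => c) * F) := by
  obtain ⟨J, hJ, hJo, rfl⟩ := hF
  refine ⟨fun μ => (fun _ => c) * J μ, fun μ => contDiff_const.mul (hJ μ),
    fun μ => (hJo μ).const_mul_left c, ?_⟩
  rw [pd_const_mul (hJ 0), pd_const_mul (hJ 1)]
  ring

lemma zero : HasNullFlux 0 :=
  ⟨fun _ _ => 0, fun _ => contDiff_const, fun _ => isLittleO_zero _ _, by simp [pd_const]⟩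

lemma sub (hF : HasNullFlux F) (hG : HasNullFlux G) : HasNullFlux (F - G) := by
  have e : F - G = F + (fun _ => (-1 : ℂ)) * G := by
    funext x
    simp [sub_eq_add_neg]
  rw [e]
  exact hF.add (hG.const_mul _)

lemma sum {ι : Type*} (s : Finset ι) (F : ι → Plane → ℂ) (hF : ∀ i ∈ s, HasNullFlux (F i)) :
    HasNullFlux (∑ i ∈ s, F i) := by
  classical
  induction s using Finset.induction_on with
  | empty => simpa using zero
  | insert i s hi ih =>
    rw [Finset.sum_insert hi]
    exact (hF i (by simp)).add (ih fun j hj => hF j (by simp [hj]))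

/-- Integrate `F` against the cutoffs: dominated convergence gives `∫ F`, while integration by parts
moves the derivative onto the cutoff and gives zero. -/
lemma integral_eq_zero (hF : HasNullFlux F) (hint : Integrable F) : ∫ x, F x = 0 := by
  have h1 : Tendsto (fun n => ∫ x, cutoff n x * F x) atTop (𝓝 (∫ x, F x)) := by
    refine tendsto_integral_of_dominated_convergence (fun x => ‖F x‖) (fun n => ?_) hint.norm
      (fun n => Eventually.of_forall fun x => ?_) (Eventually.of_forall fun x => ?_)
    · exact (contDiff_cutoff n).continuous.aestronglyMeasurable.mul hint.aestronglyMeasurable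
    · rw [norm_mul]
      exact mul_le_of_le_one_left (norm_nonneg _) (norm_cutoff_le n x)
    · obtain ⟨N, hN⟩ := exists_nat_ge ‖x‖
      refine tendsto_const_nhds.congr' ?_
      filter_upwards [eventually_ge_atTop N] with n hn
      have : (N : ℝ) ≤ n := by exact_mod_cast hn
      rw [cutoff_eq_one (by linarith), one_mul]
  obtain ⟨J, hJ, hJo, rfl⟩ := hF
  have hi : ∀ n μ, Integrable fun x => cutoff n x * pd μ (J μ) x := fun n μ =>
    ((contDiff_cutoff n).continuous.mul
      (contDiff_pd (hJ μ) μ).continuous).integrable_of_hasCompactSupport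
        (hasCompactSupport_cutoff n).mul_right
  have h2 : ∀ n, ∫ x, cutoff n x * (pd 0 (J 0) + pd 1 (J 1)) x =
      -(∫ x, pd 0 (cutoff n) x * J 0 x) + -∫ x, pd 1 (cutoff n) x * J 1 x := by
    intro n
    rw [← integral_cutoff_mul_pd (hJ 0), ← integral_cutoff_mul_pd (hJ 1),
      ← integral_add (hi n 0) (hi n 1)]
    simp only [Pi.add_apply, mul_add]
  simp only [h2] at h1
  have h3 := (tendsto_integral_pd_cutoff_mul (hJo 0) 0).neg.add
    (tendsto_integral_pd_cutoff_mul (hJo 1) 1).neg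
  simp only [neg_zero, add_zero] at h3
  exact tendsto_nhds_unique h1 h3

end HasNullFlux

/-! ### The magnetic field as a curl plus a commutator tail. -/

section GaugeField

variable {a : ℕ → Fin 2 → Plane → ℝ}

lemma gaugeA_eq (a : ℕ → Fin 2 → Plane → ℝ) (k : ℕ) :
    gaugeA a k = (fun _ => (Real.sqrt 2 : ℂ)⁻¹) *
      ((fun x => (a k 0 x : ℂ)) - (fun _ => Complex.I) * fun x => (a k 1 x : ℂ)) := by
  funext x
  simp only [gaugeA, Pi.mul_apply, Pi.sub_apply]
  ring

lemma gaugeAbar_eq (a : ℕ → Fin 2 → Plane → ℝ) (k : ℕ) :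
    gaugeAbar a k = (fun _ => (Real.sqrt 2 : ℂ)⁻¹) *
      ((fun x => (a k 0 x : ℂ)) + (fun _ => Complex.I) * fun x => (a k 1 x : ℂ)) := by
  funext x
  simp only [gaugeAbar, Pi.mul_apply, Pi.add_apply]
  ring

lemma conj_gaugeAbar (a : ℕ → Fin 2 → Plane → ℝ) (k : ℕ) (x : Plane) :
    conj (gaugeAbar a k x) = gaugeA a k x := by
  simp [gaugeA, gaugeAbar, sub_eq_add_neg]

lemma contDiff_ofReal {u : Plane → ℝ} (hu : ContDiff ℝ ∞ u) :
    ContDiff ℝ ∞ (fun x => (u x : ℂ)) :=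
  Complex.ofRealCLM.contDiff.comp hu

lemma pd_ofReal {u : Plane → ℝ} (hu : ContDiff ℝ ∞ u) (μ : Fin 2) :
    pd μ (fun x => (u x : ℂ)) =
      fun x => ((fderiv ℝ u x (EuclideanSpace.single μ 1) : ℝ) : ℂ) := by
  funext x
  have h : HasFDerivAt (fun x => (u x : ℂ)) (Complex.ofRealCLM.comp (fderiv ℝ u x)) x :=
    Complex.ofRealCLM.hasFDerivAt.comp x (hu.differentiable (by simp) x).hasFDerivAt
  simp [pd, h.fderiv]

lemma contDiff_gaugeAbar (ha : ∀ k μ, ContDiff ℝ ∞ (a k μ)) (k : ℕ) :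
    ContDiff ℝ ∞ (gaugeAbar a k) := by
  rw [gaugeAbar_eq]
  exact contDiff_const.mul
    ((contDiff_ofReal (ha k 0)).add (contDiff_const.mul (contDiff_ofReal (ha k 1))))

lemma inv_sqrt_two_mul_self : (Real.sqrt 2 : ℂ)⁻¹ * (Real.sqrt 2 : ℂ)⁻¹ = 1 / 2 := by
  rw [← mul_inv, ← Complex.ofReal_mul, Real.mul_self_sqrt (by norm_num)]
  norm_num

lemma commMagneticField_eq (ha : ∀ k μ, ContDiff ℝ ∞ (a k μ)) (k : ℕ) :
    (fun x => (commMagneticField (a k) x : ℂ)) =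
      pd 0 (fun x => (a k 1 x : ℂ)) + -pd 1 (fun x => (a k 0 x : ℂ)) := by
  funext x
  simp [pd_ofReal (ha k _), commMagneticField, sub_eq_add_neg]

lemma neg_I_mul_curl (ha : ∀ k μ, ContDiff ℝ ∞ (a k μ)) (k : ℕ) (x : Plane) :
    -Complex.I * (dz (gaugeAbar a k) x - dzbar (gaugeA a k) x) = commMagneticField (a k) x := by
  have h0 := contDiff_ofReal (ha k 0)
  have h1 := contDiff_ofReal (ha k 1)
  have hI : ContDiff ℝ ∞ ((fun _ => Complex.I) * fun x => (a k 1 x : ℂ)) :=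
    contDiff_const.mul h1
  rw [show (commMagneticField (a k) x : ℂ) = _ from congrFun (commMagneticField_eq ha k) x]
  rw [gaugeA_eq, gaugeAbar_eq, dz_eq, dzbar_eq]
  rw [pd_const_mul (f := _ + _) (h0.add hI), pd_const_mul (f := _ + _) (h0.add hI),
    pd_const_mul (f := _ - _) (h0.sub hI), pd_const_mul (f := _ - _) (h0.sub hI),
    pd_add h0 hI, pd_add h0 hI, pd_sub h0 hI, pd_sub h0 hI, pd_const_mul h1, pd_const_mul h1]
  simp only [Pi.mul_apply, Pi.add_apply, Pi.sub_apply, Pi.neg_apply]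
  have hs := inv_sqrt_two_mul_self
  have hII := Complex.I_mul_I
  set s := (Real.sqrt 2 : ℂ)⁻¹
  set i := Complex.I
  linear_combination (-(2 * i * i) * (pd 0 (fun x => (a k 1 x : ℂ)) x -
    pd 1 (fun x => (a k 0 x : ℂ)) x)) * hs -
    (pd 0 (fun x => (a k 1 x : ℂ)) x - pd 1 (fun x => (a k 0 x : ℂ)) x) * hII

/-- The part of the Moyal commutator of `A` and `Ā` which enters the magnetic field. -/
def commutatorTail (a : ℕ → Fin 2 → Plane → ℝ) : FormalField :=
  fun k => moyalTail (gaugeA a) (gaugeAbar a) k - moyalTail (gaugeAbar a) (gaugeA a) k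

/-- The underivatived terms cancel, pointwise multiplication being commutative. -/
lemma moyal_commutator (a : ℕ → Fin 2 → Plane → ℝ) (k : ℕ) (x : Plane) :
    moyal (gaugeA a) (gaugeAbar a) k x - moyal (gaugeAbar a) (gaugeA a) k x =
      commutatorTail a k x := by
  rw [moyal_eq, moyal_eq, mul_comm (PowerSeries.mk (gaugeAbar a))]
  simp [commutatorTail]

lemma magneticField_eq (ha : ∀ k μ, ContDiff ℝ ∞ (a k μ)) (k : ℕ) :
    magneticField a k = (fun x => (commMagneticField (a k) x : ℂ)) - commutatorTail a k := by
  funext x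
  rw [magneticField, moyal_commutator, Pi.sub_apply, ← neg_I_mul_curl ha]
  linear_combination commutatorTail a k x * Complex.I_mul_I

lemma magneticField_zero (ha : ∀ k μ, ContDiff ℝ ∞ (a k μ)) :
    magneticField a 0 = fun x => (commMagneticField (a 0) x : ℂ) := by
  rw [magneticField_eq ha]
  simp [commutatorTail, moyalTail_zero]

lemma mk_magneticField_eq (a : ℕ → Fin 2 → Plane → ℝ) :
    PowerSeries.mk (magneticField a) = -(PowerSeries.C (fun _ => Complex.I) *
      (seriesDz (PowerSeries.mk (gaugeAbar a)) - seriesDzbar (PowerSeries.mk (gaugeA a)))) -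
        PowerSeries.mk (commutatorTail a) := by
  ext1 k
  funext x
  simp only [PowerSeries.coeff_mk, map_sub, map_neg, PowerSeries.coeff_C_mul, seriesDz,
    seriesDzbar, Pi.sub_apply, Pi.neg_apply, Pi.mul_apply]
  rw [magneticField, moyal_commutator]
  linear_combination commutatorTail a k x * Complex.I_mul_I

end GaugeField

/-! ### Higher Moyal terms as divergences. -/

lemma bidiff_pd {f g : Plane → ℂ} (hf : ContDiff ℝ ∞ f) (hg : ContDiff ℝ ∞ g) (n : ℕ)
    (μ : Fin 2) : pd μ (bidiff n f g) = bidiff n (pd μ f) g + bidiff n f (pd μ g) := by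
  induction n generalizing f g with
  | zero => exact pd_mul hf hg μ
  | succ n ih =>
    have hf' := contDiff_pd hf
    have hg' := contDiff_pd hg
    have e : bidiff (n + 1) f g = bidiff n (pd 0 f) (pd 1 g) - bidiff n (pd 1 f) (pd 0 g) := rfl
    rw [e, pd_sub (contDiff_bidiff (hf' 0) (hg' 1) n) (contDiff_bidiff (hf' 1) (hg' 0) n),
      ih (hf' 0) (hg' 1), ih (hf' 1) (hg' 0), pd_comm hf μ 0, pd_comm hf μ 1, pd_comm hg μ 0,
      pd_comm hg μ 1]
    funext x
    simp only [bidiff, Pi.add_apply, Pi.sub_apply]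
    ring

/-- Leibniz leaves two terms containing the mixed second derivative of `g`; they cancel by the
antisymmetry of `ε` and the symmetry of second derivatives. -/
lemma bidiff_succ_eq_divergence {f g : Plane → ℂ} (hf : ContDiff ℝ ∞ f) (hg : ContDiff ℝ ∞ g)
    (n : ℕ) : bidiff (n + 1) f g =
      pd 0 (bidiff n f (pd 1 g)) + pd 1 (-bidiff n f (pd 0 g)) := by
  rw [pd_neg, bidiff_pd hf (contDiff_pd hg 1), bidiff_pd hf (contDiff_pd hg 0), pd_comm hg 1 0]
  funext x
  simp only [bidiff, Pi.add_apply, Pi.neg_apply]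
  ring

lemma IsSymbol.isLittleO_inv_norm {m : ℕ} {f : Plane → ℂ} (h : IsSymbol m f) (hm : 2 ≤ m) :
    f =o[cobounded Plane] fun x => ‖x‖⁻¹ := by
  refine (h.mono hm).isBigO.trans_isLittleO ?_
  have h1 : (fun x : Plane => ‖x‖⁻¹) =o[cobounded Plane] fun _ => (1 : ℝ) :=
    (isLittleO_one_iff ℝ).2 (tendsto_inv_atTop_zero.comp tendsto_norm_cobounded_atTop)
  simpa [pow_two] using h1.mul_isBigO (isBigO_refl (fun x : Plane => ‖x‖⁻¹) _)

/-- The currents have order `1 + 2 + 2n ≥ 3`, more than enough for `o(1/r)`. -/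
lemma hasNullFlux_bidiff_succ {f g : Plane → ℂ} (hf : IsSymbol 1 f) (hg : IsSymbol 1 g) (n : ℕ) :
    HasNullFlux (bidiff (n + 1) f g) := by
  have h1 := hf.bidiff (hg.pd 1) n
  have h0 := (hf.bidiff (hg.pd 0) n).neg
  refine ⟨![bidiff n f (pd 1 g), -bidiff n f (pd 0 g)], fun μ => ?_, fun μ => ?_,
    bidiff_succ_eq_divergence hf.smooth hg.smooth n⟩
  · fin_cases μ
    · exact h1.smooth
    · exact h0.smooth
  · fin_cases μ
    · exact h1.isLittleO_inv_norm (by omega)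
    · exact h0.isLittleO_inv_norm (by omega)

lemma hasNullFlux_moyalTail {f g : FormalField} (hf : ∀ k, IsSymbol 1 (f k))
    (hg : ∀ k, IsSymbol 1 (g k)) (k : ℕ) : HasNullFlux (moyalTail f g k) := by
  cases k with
  | zero =>
    rw [moyalTail_zero]
    exact HasNullFlux.zero
  | succ k =>
    rw [moyalTail_succ]
    exact HasNullFlux.sum _ _ fun p _ => HasNullFlux.sum _ _ fun q _ =>
      (hasNullFlux_bidiff_succ (hf q.1) (hg q.2) p.2).const_mul _

/-! ### Decay of vortex solutions. -/

namespace IsVortexSolution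

variable {a : ℕ → Fin 2 → Plane → ℝ} {φ : FormalField}

/-- With the noncommutativity confined to a tail, the equation becomes an identity in a commutative
ring of power series, open to `linear_combination`. -/
lemma seriesDzbar_higgs (h : IsVortexSolution a φ) :
    seriesDzbar (PowerSeries.mk φ) = PowerSeries.C (fun _ => Complex.I) *
      (PowerSeries.mk (gaugeAbar a) * PowerSeries.mk φ +
        PowerSeries.mk (moyalTail (gaugeAbar a) φ)) := by
  ext1 k
  funext x
  have e := h.dbar_eq k x
  rw [moyal_eq] at e
  simp only [seriesDzbar, PowerSeries.coeff_mk, PowerSeries.coeff_C_mul, map_add, Pi.mul_apply,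
    Pi.add_apply] at e ⊢
  linear_combination e

lemma mk_magneticField (h : IsVortexSolution a φ) :
    PowerSeries.mk (magneticField a) = PowerSeries.C (fun _ => 1) -
      (PowerSeries.mk φ * PowerSeries.mk (fconj φ) + PowerSeries.mk (moyalTail φ (fconj φ))) := by
  ext1 k
  funext x
  have e := h.field_eq k x
  rw [moyal_eq] at e
  simp only [PowerSeries.coeff_mk, map_sub, map_add, PowerSeries.coeff_C, Pi.sub_apply,
    Pi.add_apply] at e ⊢
  split_ifs at e ⊢ <;> simp only [Pi.zero_apply] <;> linear_combination e

lemma commMagneticField_zero (h : IsVortexSolution a φ) (x : Plane) :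
    commMagneticField (a 0) x = 1 - ‖φ 0 x‖ ^ 2 := by
  have e := h.field_eq 0 x
  rw [magneticField_zero h.smooth_gauge] at e
  simp only [moyal, Finset.HasAntidiagonal.antidiagonal_zero, Finset.sum_singleton, bidiff, fconj,
    Complex.mul_conj, Complex.normSq_eq_norm_sq, if_true] at e
  have e' : ((commMagneticField (a 0) x + ‖φ 0 x‖ ^ 2 - 1 : ℝ) : ℂ) = 0 := by
    push_cast
    simpa using e
  have := Complex.ofReal_eq_zero.1 e'
  linarith

lemma coeff_gaugeAbar_mul_higgs (h : IsVortexSolution a φ) (k : ℕ) :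
    PowerSeries.coeff k (PowerSeries.mk (gaugeAbar a) * PowerSeries.mk φ) =
      (fun _ => -Complex.I) * dzbar (φ k) - moyalTail (gaugeAbar a) φ k := by
  funext x
  have e := congrFun (congrArg (PowerSeries.coeff k) h.seriesDzbar_higgs) x
  simp only [seriesDzbar, PowerSeries.coeff_mk, PowerSeries.coeff_C_mul, map_add,
    Pi.mul_apply, Pi.add_apply, Pi.sub_apply] at e ⊢
  rw [e]
  linear_combination (PowerSeries.coeff k
    (PowerSeries.mk (gaugeAbar a) * PowerSeries.mk φ) x +
      moyalTail (gaugeAbar a) φ k x) * Complex.I_mul_I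

/-- The `∂̄`-equation expresses `Ā_k φ_0` through `∂̄φ_k`, of order 1, and terms with only earlier
`Ā_j`; induct on `k` and divide by `φ_0`. -/
lemma isSymbol_gaugeAbar (h : IsVortexSolution a φ) (hφ : ∀ k, IsSymbol 0 (φ k))
    (hlow : ∀ᶠ x in cobounded Plane, 1 / 2 ≤ ‖φ 0 x‖) (k : ℕ) : IsSymbol 1 (gaugeAbar a k) := by
  induction k using Nat.strong_induction_on with
  | _ k ih =>
    have key := IsSymbol.coeff_of_mul (m := 1) (k := k) (F := PowerSeries.mk (gaugeAbar a))
      (G := PowerSeries.mk φ) (c := 1 / 2) (fun j => by simpa using hφ j) (by norm_num)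
      (by simpa using hlow) (by simpa using contDiff_gaugeAbar h.smooth_gauge k)
      (fun j hj => by simpa using ih j hj)
    simp only [PowerSeries.coeff_mk] at key
    refine key ?_
    rw [h.coeff_gaugeAbar_mul_higgs]
    exact ((hφ k).dzbar.const_mul _).sub
      ((isSymbol_moyalTail ih fun j _ => hφ j).mono (by omega))

lemma isSymbol_gaugeA (h : IsVortexSolution a φ) (hφ : ∀ k, IsSymbol 0 (φ k))
    (hlow : ∀ᶠ x in cobounded Plane, 1 / 2 ≤ ‖φ 0 x‖) (k : ℕ) : IsSymbol 1 (gaugeA a k) := by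
  have := (h.isSymbol_gaugeAbar hφ hlow k).conjugate
  simpa only [conj_gaugeAbar] using this

/-- Solving for `Ā_k φ_0` again, every term is now `o(1/r)`: `∂̄φ_k` since `φ_k` vanishes at
infinity, the tail since it has order 3, and `Ā_i φ_{k-i}` with `i < k` since `φ_{k-i} → 0`. -/
lemma isLittleO_gaugeAbar (h : IsVortexSolution a φ) (hφ : ∀ k, IsSymbol 0 (φ k))
    (hlow : ∀ᶠ x in cobounded Plane, 1 / 2 ≤ ‖φ 0 x‖)
    (hzero : ∀ k, 0 < k → Tendsto (φ k) (cobounded Plane) (𝓝 0)) {k : ℕ} (hk : 0 < k) :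
    gaugeAbar a k =o[cobounded Plane] fun x => ‖x‖⁻¹ := by
  have hA := h.isSymbol_gaugeAbar hφ hlow
  have e := h.coeff_gaugeAbar_mul_higgs k
  rw [coeff_mul_eq_add_sum_range, ← eq_sub_iff_add_eq] at e
  simp only [PowerSeries.coeff_mk] at e
  have hd : dzbar (φ k) =o[cobounded Plane] fun x => ‖x‖⁻¹ := by
    rw [dzbar_eq]
    exact ((isLittleO_pd_of_tendsto_zero (hφ k) (hzero k hk) 0).add
      ((isLittleO_pd_of_tendsto_zero (hφ k) (hzero k hk) 1).const_mul_left _)).const_mul_left _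
  have htail : moyalTail (gaugeAbar a) φ k =o[cobounded Plane] fun x => ‖x‖⁻¹ :=
    (isSymbol_moyalTail (fun j _ => hA j) fun j _ => hφ j).isLittleO_inv_norm (by omega)
  have hsum : (∑ i ∈ Finset.range k, gaugeAbar a i * φ (k - i)) =o[cobounded Plane]
      fun x => ‖x‖⁻¹ := by
    refine IsLittleO.sum (E' := ℂ) fun i hi => ?_
    have h1 : gaugeAbar a i =O[cobounded Plane] fun x => ‖x‖⁻¹ := by
      simpa using (hA i).isBigO
    have h2 : φ (k - i) =o[cobounded Plane] fun _ => (1 : ℝ) :=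
      (isLittleO_one_iff ℝ).2 (hzero _ (Nat.sub_pos_of_lt (Finset.mem_range.1 hi)))
    have h3 := h1.mul_isLittleO h2
    simp only [mul_one] at h3
    exact h3
  have hprod : (gaugeAbar a k * φ 0) =o[cobounded Plane] fun x => ‖x‖⁻¹ := by
    rw [e]
    exact ((hd.const_mul_left _).sub htail).sub hsum
  refine IsBigO.trans_isLittleO (IsBigO.of_bound 2 ?_) hprod
  filter_upwards [hlow] with x hx
  rw [Pi.mul_apply, norm_mul]
  nlinarith [norm_nonneg (gaugeAbar a k x)]

/-- A bootstrap. The curvature formula gives `B` order 2. Applying `∂̄` to the field equation gives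
`ψb Φ`, hence the covariant derivatives `ψb` and `ψ`, order 3. The commutator of covariant
derivatives on `Φ` then gives `B Φ`, hence `B`, order 4. -/
lemma isSymbol_magneticField (h : IsVortexSolution a φ) (hφ : ∀ k, IsSymbol 0 (φ k))
    (hlow : ∀ᶠ x in cobounded Plane, 1 / 2 ≤ ‖φ 0 x‖) (k : ℕ) :
    IsSymbol 4 (magneticField a k) := by
  have hA := h.isSymbol_gaugeA hφ hlow
  have hAb := h.isSymbol_gaugeAbar hφ hlow
  have hφb : ∀ k, IsSymbol 0 (fconj φ k) := fun k => (hφ k).conjugate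
  have eHiggs := h.seriesDzbar_higgs
  have eField := h.mk_magneticField
  have eCurv := mk_magneticField_eq a
  have hT₁ : IsSymbolSeries 3 (PowerSeries.mk (moyalTail (gaugeAbar a) φ)) := fun j => by
    simpa using isSymbol_moyalTail (fun i _ => hAb i) (fun i (_ : i < j) => hφ i)
  have hT₂ : IsSymbolSeries 4 (PowerSeries.mk (commutatorTail a)) := fun j => by
    simpa [commutatorTail] using
      (isSymbol_moyalTail (fun i _ => hA i) (fun i (_ : i < j) => hAb i)).sub
        (isSymbol_moyalTail (fun i _ => hAb i) (fun i (_ : i < j) => hA i))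
  have hT₃ : IsSymbolSeries 2 (PowerSeries.mk (moyalTail φ (fconj φ))) := fun j => by
    simpa using isSymbol_moyalTail (fun i _ => hφ i) (fun i (_ : i < j) => hφb i)
  have hΦ : IsSymbolSeries 0 (PowerSeries.mk φ) := fun j => by simpa using hφ j
  have hΦb : IsSymbolSeries 0 (PowerSeries.mk (fconj φ)) := fun j => by simpa using hφb j
  have hS : IsSymbolSeries 1 (PowerSeries.mk (gaugeA a)) := fun j => by simpa using hA j
  have hSb : IsSymbolSeries 1 (PowerSeries.mk (gaugeAbar a)) := fun j => by simpa using hAb j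
  have hlow' : ∀ᶠ x in cobounded Plane, 1 / 2 ≤ ‖PowerSeries.coeff 0 (PowerSeries.mk φ) x‖ := by
    simpa using hlow
  -- `Dφ = ∂φ - iAφ` is the conjugate of `∂̄φ̄ + iĀφ̄`, because the components `A_μ` are real. Decay
  -- proved for the latter thus passes to `Dφ`.
  have hψ_conj : ∀ (j : ℕ) (x : Plane), PowerSeries.coeff (R := Plane → ℂ) j
      (seriesDz (PowerSeries.mk φ) - PowerSeries.C (fun _ => Complex.I) * (PowerSeries.mk (gaugeA a) * PowerSeries.mk φ)) x =
      conj (PowerSeries.coeff (R := Plane → ℂ) j (seriesDzbar (PowerSeries.mk (fconj φ)) +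
        PowerSeries.C (fun _ => Complex.I) *
          (PowerSeries.mk (gaugeAbar a) * PowerSeries.mk (fconj φ))) x) := by
    intro j x
    have hpd : ∀ μ, pd μ (fconj φ j) x = conj (pd μ (φ j) x) := fun μ =>
      congrFun (pd_conj (hφ j).smooth μ) x
    simp only [map_sub, map_add, seriesDz, seriesDzbar, PowerSeries.coeff_mk,
      PowerSeries.coeff_C_mul, Pi.sub_apply, Pi.add_apply, Pi.mul_apply]
    simp only [PowerSeries.coeff_mul, PowerSeries.coeff_mk, Pi.mul_apply, Finset.sum_apply, dz,
      dzbar, hpd, map_add, map_mul, map_sum, conj_gaugeAbar, fconj, map_div₀,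
      Complex.conj_conj, Complex.conj_I, Complex.conj_ofReal]
    ring
  generalize PowerSeries.mk φ = Φ at *
  generalize PowerSeries.mk (fconj φ) = Φb at *
  generalize PowerSeries.mk (gaugeA a) = S at *
  generalize PowerSeries.mk (gaugeAbar a) = Sb at *
  generalize PowerSeries.mk (moyalTail (gaugeAbar a) φ) = T₁ at *
  generalize PowerSeries.mk (commutatorTail a) = T₂ at *
  generalize PowerSeries.mk (moyalTail φ (fconj φ)) = T₃ at *
  suffices hB : IsSymbolSeries 4 (PowerSeries.mk (magneticField a)) by simpa using hB k
  generalize PowerSeries.mk (magneticField a) = B at *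
  have hι : PowerSeries.C (R := Plane → ℂ) (fun _ => Complex.I) *
      PowerSeries.C (fun _ => Complex.I) = -1 := by
    rw [← map_mul, show ((fun _ => Complex.I) * fun _ => Complex.I : Plane → ℂ) = -1 by
      funext x; simp, map_neg, map_one]
  have hB₂ : IsSymbolSeries 2 B := by
    rw [eCurv]
    exact ((hSb.dz.sub hS.dzbar).C_mul _).neg.sub (hT₂.mono (by omega))
  set ψ := seriesDz Φ - PowerSeries.C (fun _ => Complex.I) * (S * Φ) with hψ
  set ψb := seriesDzbar Φb + PowerSeries.C (fun _ => Complex.I) * (Sb * Φb) with hψb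
  have hψb₁ : IsSymbolSeries 1 ψb := hΦb.dzbar.add ((hSb.mul hΦb).C_mul _)
  have hψb₃ : IsSymbolSeries 3 ψb := by
    refine IsSymbolSeries.of_mul hΦ (by norm_num) hlow' (fun j => (hψb₁ j).smooth) ?_
    -- Apply `∂̄` to `B + ΦΦ̄ + T₃ = 1` and substitute `∂̄Φ = i(ĀΦ + T₁)`; the terms with factor `Φ`
    -- assemble into `ψb Φ`.
    have e : ψb * Φ = -seriesDzbar B - seriesDzbar T₃ -
        PowerSeries.C (fun _ => Complex.I) * (T₁ * Φb) := by
      have e1 : seriesDzbar (B + (Φ * Φb + T₃)) = 0 := by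
        rw [eField, sub_add_cancel, seriesDzbar_C]
      rw [seriesDzbar_add hB₂ ((hΦ.mul hΦb).add (hT₃.mono (Nat.zero_le 2))),
        seriesDzbar_add (hΦ.mul hΦb) hT₃, seriesDzbar_mul hΦ hΦb, eHiggs] at e1
      rw [hψb]
      linear_combination e1
    rw [e]
    exact (hB₂.dzbar.neg.sub hT₃.dzbar).sub ((hT₁.mul hΦb).C_mul _)
  have hψ₃ : IsSymbolSeries 3 ψ := fun j => by
    have := (hψb₃ j).conjugate
    simpa only [← hψ_conj] using this
  refine IsSymbolSeries.of_mul hΦ (by norm_num) hlow' (fun j => (hB₂ j).smooth) ?_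
  -- From `∂̄∂Φ = ∂∂̄Φ`, with `∂Φ` and `∂̄Φ` rewritten by the definition of `ψ` and the Higgs
  -- equation: the derivatives of `A` and `Ā` combine into the curvature, and each remaining term
  -- has order 4.
  have e : B * Φ = -seriesDzbar ψ + PowerSeries.C (fun _ => Complex.I) * (Sb * ψ) +
      PowerSeries.C (fun _ => Complex.I) * seriesDz T₁ + S * T₁ - T₂ * Φ := by
    have e1 : seriesDzbar (ψ + PowerSeries.C (fun _ => Complex.I) * (S * Φ)) =
        seriesDz (seriesDzbar Φ) := by
      rw [hψ, sub_add_cancel, seriesDzbar_dz hΦ]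
    rw [seriesDzbar_add hψ₃ ((hS.mul hΦ).C_mul _), seriesDzbar_C_mul _ (hS.mul hΦ),
      seriesDzbar_mul hS hΦ, eHiggs,
      seriesDz_C_mul _ ((hSb.mul hΦ).add (hT₁.mono (by omega))),
      seriesDz_add (hSb.mul hΦ) hT₁, seriesDz_mul hSb hΦ] at e1
    have e2 : seriesDz Φ = ψ + PowerSeries.C (fun _ => Complex.I) * (S * Φ) := by
      rw [hψ, sub_add_cancel]
    rw [e2] at e1
    rw [eCurv]
    linear_combination e1 - S * T₁ * hι
  rw [e]
  exact ((((hψ₃.dzbar.neg.add ((hSb.mul hψ₃).C_mul _)).add (hT₁.dz.C_mul _)).add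
    (hS.mul hT₁)).sub (hT₂.mul hΦ))

/-- The curl is the divergence of `(A_2, -A_1)`, which is `o(1/r)` for `k ≥ 1`; the commutator tail
is a divergence in every order. -/
lemma hasNullFlux_magneticField (h : IsVortexSolution a φ) (hφ : ∀ k, IsSymbol 0 (φ k))
    (hlow : ∀ᶠ x in cobounded Plane, 1 / 2 ≤ ‖φ 0 x‖)
    (hzero : ∀ k, 0 < k → Tendsto (φ k) (cobounded Plane) (𝓝 0)) {k : ℕ} (hk : 0 < k) :
    HasNullFlux (magneticField a k) := by
  have hA := h.isSymbol_gaugeA hφ hlow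
  have hAb := h.isSymbol_gaugeAbar hφ hlow
  rw [magneticField_eq h.smooth_gauge]
  refine HasNullFlux.sub ?_ ((hasNullFlux_moyalTail hA hAb k).sub (hasNullFlux_moyalTail hAb hA k))
  have hcoord : ∀ μ, (fun x => (a k μ x : ℂ)) =o[cobounded Plane] fun x => ‖x‖⁻¹ := by
    intro μ
    refine IsBigO.trans_isLittleO (IsBigO.of_bound (Real.sqrt 2) (Eventually.of_forall fun x => ?_))
      (h.isLittleO_gaugeAbar hφ hlow hzero hk)
    have hs : (0 : ℝ) < Real.sqrt 2 := by positivity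
    -- For real components, `√2 Ā` has real part `A_1` and imaginary part `A_2`, so its modulus
    -- bounds both.
    have e : Real.sqrt 2 * ‖gaugeAbar a k x‖ = ‖(a k 0 x : ℂ) + (a k 1 x : ℂ) * Complex.I‖ := by
      rw [gaugeAbar, norm_div, Complex.norm_real, Real.norm_of_nonneg hs.le,
        mul_div_cancel₀ _ hs.ne', mul_comm Complex.I]
    rw [e, Complex.norm_real, Real.norm_eq_abs]
    fin_cases μ
    · simpa using Complex.abs_re_le_norm ((a k 0 x : ℂ) + (a k 1 x : ℂ) * Complex.I)
    · simpa using Complex.abs_im_le_norm ((a k 0 x : ℂ) + (a k 1 x : ℂ) * Complex.I)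
  refine ⟨![fun x => (a k 1 x : ℂ), -fun x => (a k 0 x : ℂ)], fun μ => ?_, fun μ => ?_, ?_⟩
  · fin_cases μ
    · exact contDiff_ofReal (h.smooth_gauge k 1)
    · exact (contDiff_ofReal (h.smooth_gauge k 0)).neg
  · fin_cases μ
    · exact hcoord 1
    · exact (hcoord 0).neg_left
  · rw [commMagneticField_eq h.smooth_gauge, ← pd_neg]
    rfl

end IsVortexSolution

lemma tendsto_zero_of_norm_lt_rpow {f : Plane → ℂ} {ε C R : ℝ} (hε : 0 < ε)
    (h : ∀ x : Plane, R < ‖x‖ → ‖f x‖ < C * ‖x‖ ^ (-ε)) :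
    Tendsto f (cobounded Plane) (𝓝 0) := by
  have hlim : Tendsto (fun x : Plane => C * ‖x‖ ^ (-ε)) (cobounded Plane) (𝓝 0) := by
    simpa using ((tendsto_rpow_neg_atTop hε).comp tendsto_norm_cobounded_atTop).const_mul C
  refine squeeze_zero_norm' ?_ hlim
  filter_upwards [tendsto_norm_cobounded_atTop.eventually_gt_atTop R] with x hx
  exact (h x hx).le

end NCVortex

end

/-! ### Integrability and quantisation of the vortex number. -/

theorem mainTheorem2
    (a : ℕ → Fin 2 → NCVortex.Plane → ℝ) (φ : NCVortex.FormalField) (N₀ : ℝ)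
    (hsol : NCVortex.IsVortexSolution a φ)
    (hint : MeasureTheory.Integrable (NCVortex.commMagneticField (a 0)))
    (hN₀ : 1 / (2 * Real.pi) * ∫ x, NCVortex.commMagneticField (a 0) x = N₀)
    (htame : ∀ k, NCVortex.TameAtInfinity (φ k))
    (hdecay : ∀ k, 0 < k → ∃ ε C R : ℝ, 0 < ε ∧ ∀ x : NCVortex.Plane, R < ‖x‖ →
      ‖φ k x‖ < C * ‖x‖ ^ (-ε) ∧ ‖NCVortex.radialDeriv (φ k) x‖ < C * ‖x‖ ^ (-ε + 1)) :
    (∀ k, MeasureTheory.Integrable (NCVortex.magneticField a k)) ∧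
      NCVortex.vortexNumber a = PowerSeries.C (N₀ : ℂ) := by
  have hφ : ∀ k, NCVortex.IsSymbol 0 (φ k) := fun k => (htame k).isSymbol (hsol.smooth_higgs k)
  have hlow : ∀ᶠ x in Bornology.cobounded NCVortex.Plane, 1 / 2 ≤ ‖φ 0 x‖ :=
    (hφ 0).eventually_half_le_norm (by simpa only [← hsol.commMagneticField_zero] using hint)
  have hzero : ∀ k, 0 < k →
      Filter.Tendsto (φ k) (Bornology.cobounded NCVortex.Plane) (nhds 0) := by
    intro k hk
    obtain ⟨ε, C, R, hε, hb⟩ := hdecay k hk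
    exact NCVortex.tendsto_zero_of_norm_lt_rpow hε fun x hx => (hb x hx).1
  have hB : ∀ k, MeasureTheory.Integrable (NCVortex.magneticField a k) := fun k =>
    ((hsol.isSymbol_magneticField hφ hlow k).mono (by norm_num)).integrable
  refine ⟨hB, ?_⟩
  ext k
  rw [NCVortex.vortexNumber, PowerSeries.coeff_mk, PowerSeries.coeff_C]
  split_ifs with hk
  · subst hk
    rw [NCVortex.magneticField_zero hsol.smooth_gauge, integral_complex_ofReal, ← hN₀]
    push_cast
    ring
  · rw [(hsol.hasNullFlux_magneticField hφ hlow hzero (Nat.pos_of_ne_zero hk)).integral_eq_zero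
      (hB k), mul_zero]
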